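/- **Definitions.** A precubical set is a graded set $P=(P_n)_{n\ge 0}$ with face operators $d^k_i\colon P_n\to P_{n-1}$ ($n>0$, $k\in\{0,1\}$, $1\le i\le n$) such that $d^k_i d^l_j = d^l_{j-1}d^k_i$ for $i<j$. The elements of $P_n$ are the $n$-cubes of $P$, and those of $P_0$ are its vertices. The precubical interval $\llbracket 0,k\rrbracket$ has vertices $0,\dots,k$, edges $[j-1,j]$ with $d^0_1[j-1,j]=j-1$ and $d^1_1[j-1,j]=j$ ($1\le j\le k$), and no cubes of degree $\ge 2$. The elements of the tensor power $\llbracket 0,1\rrbracket^{\otimes n}$ are the words of length $n$ in the letters $0$, $1$, $[0,1]$; the degree of a word is the number of its letters $[0,1]$, and $d^k_i$ replaces the $i$-th of these by $k$. For an $n$-cube $x$ of $P$, $x_\sharp\colon\llbracket 0,1\rrbracket^{\otimes n}\to P$ denotes the unique morphism that sends the element of degree $n$ to $x$, and $x$ is regular if $x_\sharp$ is injective. The star of $x$ is $\mathrm{star}(x)=\{y\in P : x\in y_\sharp(\llbracket 0,1\rrbracket^{\otimes \deg y})\}$; the graded set $P\setminus\mathrm{star}(x)$ is a precubical subset of $P$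 (i.e., it is stable under the face operators). The geometric realization of $P$ is $|P|=\big(\coprod_n P_n\times[0,1]^n\big)/\!\sim$, where $P_n$ is discrete and $\sim$ is generated by $(d^k_ix,u)\sim(x,\delta^k_i(u))$, with $\delta^k_i$ inserting the coordinate $k$ in the $i$-th place. For vertices $v,w$ of $P$, write $v\to_P w$ if there is a path in $P$ from $v$ to $w$, i.e., a morphism $\omega\colon\llbracket 0,k\rrbracket\to P$ with $k\ge 0$, $\omega(0)=v$ and $\omega(k)=w$. Let $H_*$ denote singular homology with coefficients in a commutative unital ring $R$. A class $\alpha\in H_*(|P|)$ points to a class $\beta\in H_*(|P|)$, written $\alpha\nearrow\beta$, if there are precubical subsets $X,Y\subseteq P$ such that $\alpha\in\mathrm{im}(H_*(|X|)\to H_*(|P|))$, $\beta\in\mathrm{im}(H_*(|Y|)\to H_*(|P|))$, and $v\to_P w$ for all vertices $v\in X_0$ and $w\in Y_0$. The homology graph of $P$ is the directed graph whose vertices are the homology classes of $|P|$ and whose edges are given by $\nearrow$. **Theorem.** Let $R$ be a commutative unital ring, let $x$ be a regular cube of degree $n\ge 2$ of a precubical set $P$, and let $k_1,\dots,k_n\in\{0,1\}$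 be such that at least one $k_i$ is $0$ and at least one $k_i$ is $1$. Let $v=d^{k_n}_1\cdots d^{k_1}_1x$, suppose that $\mathrm{star}(v)\subseteq x_\sharp(\llbracket 0,1\rrbracket^{\otimes n})$, and let $Q=P\setminus\mathrm{star}(v)$. Then the inclusion $\iota\colon|Q|\hookrightarrow|P|$ is a homotopy equivalence, and the induced map $\iota_*\colon H_*(|Q|)\to H_*(|P|)$ is an isomorphism of homology graphs, i.e., it is bijective and $\alpha\nearrow\beta$ if and only if $\iota_*(\alpha)\nearrow\iota_*(\beta)$, for all $\alpha,\beta\in H_*(|Q|)$. -/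

import Mathlib

open scoped unitInterval DirectSum

universe u v

/-- A precubical set: a graded set with face operators `d^k_i`. The superscript `k ∈ {0, 1}` is a
`Bool` (`false` is `0`, `true` is `1`), and the subscript `i` is numbered from `0` instead of `1`,
so that the cubical identity for `i < j` is written with the pair `(i, j + 1)`, `i ≤ j`. -/
structure PrecubicalSet where
  /-- The set of `n`-cubes. -/
  cube : ℕ → Type u
  /-- The face operators. -/
  face : ∀ {n : ℕ}, Bool → Fin (n + 1) → cube (n + 1) → cube n
  face_face : ∀ {n : ℕ} (k l : Bool) (i j : Fin (n + 1)), i ≤ j → ∀ x : cube (n + 2),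
    face k i (face l j.succ x) = face l j (face k i.castSucc x)

namespace PrecubicalSet

/-! ### Morphisms -/

/-- A morphism of precubical sets. -/
@[ext]
structure Hom (P : PrecubicalSet.{u}) (Q : PrecubicalSet.{v}) where
  /-- The map in each degree. -/
  app : ∀ n : ℕ, P.cube n → Q.cube n
  app_face : ∀ {n : ℕ} (k : Bool) (i : Fin (n + 1)) (x : P.cube (n + 1)),
    app n (P.face k i x) = Q.face k i (app (n + 1) x)

/-! ### The standard cube and the characteristic morphism of a cube -/

/-- The elements of degree `m` of the precubical `n`-cube `⟦0,1⟧^{⊗ n}`: words `w₁ ⊗ ⋯ ⊗ wₙ` in the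
letters `0`, `1` and `[0,1]`, in which `[0,1]` occurs exactly `m` times. -/
inductive CubeWord : ℕ → ℕ → Type
  | nil : CubeWord 0 0
  /-- Prepend the letter `k`, where `k` is `0` or `1`. -/
  | vert {n m : ℕ} (k : Bool) (w : CubeWord n m) : CubeWord (n + 1) m
  /-- Prepend the letter `[0,1]`. -/
  | edge {n m : ℕ} (w : CubeWord n m) : CubeWord (n + 1) (m + 1)

/-- The face `d^k_i` of a word: its `i`-th letter `[0,1]` is replaced by `k`. -/
def CubeWord.face (k : Bool) : ∀ {n m : ℕ}, Fin (m + 1) → CubeWord n (m + 1) → CubeWord n m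
  | _, _, i, .vert l w => .vert l (CubeWord.face k i w)
  | _, 0, _, .edge w => .vert k w
  | _, _ + 1, i, .edge w => Fin.cases (.vert k w) (fun j => .edge (CubeWord.face k j w)) i

@[simp] theorem CubeWord.face_vert (k l : Bool) {n m : ℕ} (i : Fin (m + 1))
    (w : CubeWord n (m + 1)) : (CubeWord.vert l w).face k i = .vert l (w.face k i) := by
  cases m <;> simp [CubeWord.face]

@[simp] theorem CubeWord.face_edge_zero (k : Bool) {n m : ℕ} (w : CubeWord n m) :
    (CubeWord.edge w).face k 0 = .vert k w := by
  cases m <;> simp [CubeWord.face]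

@[simp] theorem CubeWord.face_edge_succ (k : Bool) {n m : ℕ} (i : Fin (m + 1))
    (w : CubeWord n (m + 1)) : (CubeWord.edge w).face k i.succ = .edge (w.face k i) := by
  simp [CubeWord.face]

theorem CubeWord.face_face (k l : Bool) : ∀ {n m : ℕ} (i j : Fin (m + 1)), i ≤ j →
    ∀ w : CubeWord n (m + 2),
      (w.face l j.succ).face k i = (w.face k i.castSucc).face l j
  | _, _, i, j, h, .vert a w => by
      simp [CubeWord.face_face k l i j h w]
  | _, m, i, j, h, .edge w => by
      induction i using Fin.cases with
      | zero => simp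
      | succ i =>
        cases m with
        | zero => exact i.elim0
        | succ m =>
          induction j using Fin.cases with
          | zero => simp at h
          | succ j =>
            rw [← Fin.succ_castSucc]
            simp [CubeWord.face_face k l i j (by simpa using h) w]

/-- The precubical `n`-cube `⟦0,1⟧^{⊗ n}`. -/
def stdCube (n : ℕ) : PrecubicalSet.{0} where
  cube m := CubeWord n m
  face k i w := w.face k i
  face_face k l i j h w := CubeWord.face_face k l i j h w

/-- The only element `ι_n = [0,1] ⊗ ⋯ ⊗ [0,1]` of degree `n` of the precubical `n`-cube. -/
def topCube : ∀ n : ℕ, (stdCube n).cube n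
  | 0 => CubeWord.nil
  | n + 1 => CubeWord.edge (topCube n)

/-- The precubical set of all cubes of positive degree of `P`, with degrees lowered by one, and with
the face operators that do not concern the first coordinate. It serves to define `x_♯`. -/
def shift (P : PrecubicalSet.{u}) : PrecubicalSet.{u} where
  cube n := P.cube (n + 1)
  face k i x := P.face k i.succ x
  face_face k l i j h x := by
    have := P.face_face k l i.succ j.succ (by simpa using h) x
    rwa [← Fin.succ_castSucc] at this

/-- The value of `x_♯` on a word: a letter `k ∈ {0, 1}` in the first place is evaluated by taking
the face `d^k_1`, a letter `[0,1]` by leaving the first coordinate alone. -/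
def sharpFun : ∀ {n m : ℕ} (P : PrecubicalSet.{u}), P.cube n → CubeWord n m → P.cube m
  | _, _, _, x, .nil => x
  | _, _, P, x, .vert k w => sharpFun P (P.face k 0 x) w
  | _, _, P, x, .edge w => sharpFun P.shift x w

theorem Hom.app_sharpFun {n m : ℕ} (w : CubeWord n m) :
    ∀ {P : PrecubicalSet.{u}} {Q : PrecubicalSet.{v}} (f : Hom P Q) (x : P.cube n),
      f.app m (sharpFun P x w) = sharpFun Q (f.app n x) w := by
  induction w with
  | nil => intro P Q f x; rfl
  | vert k w ih =>
    intro P Q f x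
    simp only [sharpFun]
    rw [ih f, f.app_face]
  | edge w ih =>
    intro P Q f x
    exact ih (P := P.shift) (Q := Q.shift)
      ⟨fun n => f.app (n + 1), fun k i x => f.app_face k i.succ x⟩ x

theorem sharpFun_face {n m' : ℕ} (w : CubeWord n m') : ∀ (P : PrecubicalSet.{u}) {m : ℕ}
    (hm : m' = m + 1) (k : Bool) (i : Fin (m + 1)) (x : P.cube n),
      sharpFun P x ((hm ▸ w : CubeWord n (m + 1)).face k i) =
        P.face k i (sharpFun P x (hm ▸ w : CubeWord n (m + 1))) := by
  induction w with
  | nil => intro P m hm; omega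
  | vert l w ih =>
    intro P m hm k i x
    subst hm
    simpa [sharpFun] using ih P rfl k i (P.face l 0 x)
  | @edge n m₀ w ih =>
    intro P m hm k i x
    obtain rfl : m₀ = m := by omega
    induction i using Fin.cases with
    | zero =>
      simp only [CubeWord.face_edge_zero, sharpFun]
      exact (Hom.app_sharpFun w (P := P.shift) (Q := P)
        ⟨fun _ y => P.face k 0 y, fun l j y => P.face_face k l 0 j (Fin.zero_le _) y⟩ x).symm
    | succ i =>
      cases m₀ with
      | zero => exact i.elim0
      | succ m₀ =>
        simp only [CubeWord.face_edge_succ, sharpFun]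
        exact ih P.shift rfl k i x

/-- The morphism `x_♯ : ⟦0,1⟧^{⊗ n} → P` of an `n`-cube `x` of `P`. -/
def sharp (P : PrecubicalSet.{u}) {n : ℕ} (x : P.cube n) : Hom (stdCube n) P where
  app _ w := sharpFun P x w
  app_face k i w := sharpFun_face w P rfl k i x

theorem sharp_topCube (P : PrecubicalSet.{u}) {n : ℕ} (x : P.cube n) :
    (P.sharp x).app n (topCube n) = x := by
  change sharpFun P x (topCube n) = x
  induction n generalizing P with
  | zero => rfl
  | succ n ih => exact ih P.shift x

theorem sharpFun_stdCube {n m : ℕ} (w : CubeWord n m) :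
    sharpFun (stdCube n) (topCube n) w = w := by
  induction w with
  | nil => rfl
  | @vert n m k w ih =>
    have h : (stdCube (n + 1)).face k 0 (topCube (n + 1)) = CubeWord.vert k (topCube n) := by
      exact CubeWord.face_edge_zero k _
    simp only [sharpFun]
    rw [h]
    have := Hom.app_sharpFun w (P := stdCube n) (Q := stdCube (n + 1))
      ⟨fun _ v => CubeWord.vert k v, fun l i v => (CubeWord.face_vert l k i v).symm⟩ (topCube n)
    rw [ih] at this
    exact this.symm
  | @edge n m w ih =>
    have := Hom.app_sharpFun w (P := stdCube n) (Q := (stdCube (n + 1)).shift)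
      ⟨fun _ v => CubeWord.edge v, fun l i v => (CubeWord.face_edge_succ l i v).symm⟩ (topCube n)
    rw [ih] at this
    exact this.symm

/-- `x_♯` is the only morphism from the precubical `n`-cube to `P` that sends `ι_n` to `x`. -/
theorem sharp_unique (P : PrecubicalSet.{u}) {n : ℕ} (x : P.cube n) (f : Hom (stdCube n) P)
    (hf : f.app n (topCube n) = x) : f = P.sharp x := by
  ext m w
  have := Hom.app_sharpFun w f (topCube n)
  rw [hf] at this
  exact (congrArg (f.app m) (sharpFun_stdCube w)).symm.trans this

/-- A cube `x` is regular if `x_♯` is injective. -/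
def IsRegularCube (P : PrecubicalSet.{u}) {n : ℕ} (x : P.cube n) : Prop :=
  ∀ m : ℕ, Function.Injective ((P.sharp x).app m)

/-- The vertex `d^{k_n}_1 ⋯ d^{k_1}_1 x` of an `n`-cube `x`. -/
def corner (P : PrecubicalSet.{u}) : ∀ {n : ℕ}, P.cube n → (Fin n → Bool) → P.cube 0
  | 0, x, _ => x
  | _ + 1, x, k => P.corner (P.face (k 0) 0 x) (Fin.tail k)

/-- The star of an `m`-cube `x`, by degrees: an `n`-cube `y` belongs to it if `x` lies in the image
of `y_♯`. -/
def star (P : PrecubicalSet.{u}) {m : ℕ} (x : P.cube m) (n : ℕ) : Set (P.cube n) :=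
  {y | x ∈ Set.range ((P.sharp y).app m)}

/-! ### Precubical subsets -/

/-- A precubical subset: a graded subset that is stable under the face operators. -/
structure Subset (P : PrecubicalSet.{u}) where
  /-- The cubes of degree `n` of the subset. -/
  carrier : ∀ n : ℕ, Set (P.cube n)
  face_mem : ∀ {n : ℕ} (k : Bool) (i : Fin (n + 1)) {x : P.cube (n + 1)},
    x ∈ carrier (n + 1) → P.face k i x ∈ carrier n

/-- A precubical subset as a precubical set. -/
def Subset.toPrecubicalSet {P : PrecubicalSet.{u}} (X : P.Subset) : PrecubicalSet.{u} where
  cube n := X.carrier n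
  face k i x := ⟨P.face k i x.1, X.face_mem k i x.2⟩
  face_face k l i j h x := Subtype.ext (P.face_face k l i j h x.1)

/-- The inclusion of a precubical subset. -/
def Subset.incl {P : PrecubicalSet.{u}} (X : P.Subset) : Hom X.toPrecubicalSet P where
  app _ x := x.1
  app_face _ _ _ := rfl

/-- The precubical subset `P \ star(x)`. -/
def starCompl (P : PrecubicalSet.{u}) {m : ℕ} (x : P.cube m) : P.Subset where
  carrier n := (P.star x n)ᶜ
  face_mem {n} k i y hy := by
    rintro ⟨w, hw⟩
    refine hy ⟨((stdCube (n + 1)).sharp ((topCube (n + 1) : CubeWord _ _).face k i)).app m w, ?_⟩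
    have h1 := Hom.app_sharpFun w (P.sharp y) ((topCube (n + 1) : CubeWord _ _).face k i)
    have h2 := (P.sharp y).app_face k i (topCube (n + 1))
    rw [sharp_topCube] at h2
    exact h1.trans ((congrArg (fun z => sharpFun P z w) h2).trans hw)

/-! ### Paths -/

/-- The elements of degree `n` of the precubical interval `⟦0,k⟧`: the vertices `0, …, k` and the
edges `[0,1], …, [k-1,k]`, where `[j,j+1]` is called `j`. -/
def IntervalCube (k : ℕ) : ℕ → Type
  | 0 => Fin (k + 1)
  | 1 => Fin k
  | _ + 2 => Empty

/-- The precubical interval `⟦0,k⟧`. -/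
def interval (k : ℕ) : PrecubicalSet.{0} where
  cube := IntervalCube k
  face {m} :=
    match m with
    | 0 => fun b _ (j : Fin k) => (if b then j.succ else j.castSucc : Fin (k + 1))
    | _ + 1 => fun _ _ (e : Empty) => e.elim
  face_face _ _ _ _ _ e := Empty.elim (show Empty from e)

/-- `w` is accessible from `v`, written `v →_P w`: there is a path in `P`, i.e., a morphism from an
interval `⟦0,k⟧` to `P`, that leads from `v` to `w`. -/
def Accessible (P : PrecubicalSet.{u}) (v w : P.cube 0) : Prop :=
  ∃ (k : ℕ) (ω : Hom (interval k) P),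
    ω.app 0 (0 : Fin (k + 1)) = v ∧ ω.app 0 (Fin.last k) = w

/-! ### Geometric realization -/

/-- The disjoint union of the spaces `P_n × [0,1]^n`, i.e., of one topological cube `[0,1]^n` for
each `n`-cube of `P`. -/
abbrev PreRealization (P : PrecubicalSet.{u}) : Type u :=
  Σ c : (Σ n : ℕ, P.cube n), (Fin c.1 → I)

/-- The map `δ^k_i : [0,1]^n → [0,1]^{n+1}` that inserts the coordinate `k` in the place `i`. -/
def coface {n : ℕ} (k : Bool) (i : Fin (n + 1)) (t : Fin n → I) : Fin (n + 1) → I :=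
  Fin.insertNth (α := fun _ => I) i (if k then 1 else 0) t

/-- The relation `(d^k_i x, t) ∼ (x, δ^k_i(t))`. -/
inductive Glue (P : PrecubicalSet.{u}) : P.PreRealization → P.PreRealization → Prop
  | mk {n : ℕ} (k : Bool) (i : Fin (n + 1)) (x : P.cube (n + 1)) (t : Fin n → I) :
    Glue P ⟨⟨n, P.face k i x⟩, t⟩ ⟨⟨n + 1, x⟩, coface k i t⟩

/-- The geometric realization `|P|`: the quotient of the disjoint union of the cubes by the
equivalence relation that `Glue` generates. -/
def Realization (P : PrecubicalSet.{u}) : Type u :=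
  Quot P.Glue

instance (P : PrecubicalSet.{u}) : TopologicalSpace P.Realization :=
  inferInstanceAs (TopologicalSpace (Quot P.Glue))

/-- The continuous map `|f| : |P| → |Q|` induced by a morphism `f`. -/
def Hom.realization {P : PrecubicalSet.{u}} {Q : PrecubicalSet.{v}} (f : Hom P Q) :
    C(P.Realization, Q.Realization) where
  toFun := Quot.lift
    (fun p => Quot.mk _ (⟨⟨p.1.1, f.app p.1.1 p.1.2⟩, p.2⟩ : Q.PreRealization)) (by
      rintro _ _ ⟨k, i, x, t⟩
      have h := Quot.sound (Glue.mk k i (f.app _ x) t)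
      rw [← f.app_face] at h
      exact h)
  continuous_toFun := by
    refine continuous_quot_lift _ (continuous_sigma fun c => ?_)
    have h : Continuous fun t : Fin c.1 → I =>
        (⟨⟨c.1, f.app c.1 c.2⟩, t⟩ : Q.PreRealization) := by
      exact @continuous_sigmaMk (Σ n : ℕ, Q.cube n) (fun c => (Fin c.1 → I)) _
        ⟨c.1, f.app c.1 c.2⟩
    exact continuous_quot_mk.comp h

/-! ### The homology graph -/

noncomputable section

/-- The singular homology `H_n(|P|)` with coefficients in the ring `R`. -/
def homology (R : Type v) [CommRing R] (P : PrecubicalSet.{u}) (n : ℕ) :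
    ModuleCat.{max u v} R :=
  ((AlgebraicTopology.singularHomologyFunctor.{u} (ModuleCat.{max u v} R) n).obj
    (ModuleCat.of R (ULift.{u} R))).obj (TopCat.of P.Realization)

/-- The total homology `H_*(|P|)`. -/
abbrev TotalHomology (R : Type v) [CommRing R] (P : PrecubicalSet.{u}) : Type (max u v) :=
  ⨁ n : ℕ, P.homology R n

/-- The map `H_*(|P|) → H_*(|Q|)` induced by a morphism `f : P → Q`. -/
def Hom.homologyMap (R : Type v) [CommRing R] {P Q : PrecubicalSet.{u}} (f : Hom P Q) :
    P.TotalHomology R →ₗ[R] Q.TotalHomology R :=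
  DirectSum.lmap fun n : ℕ =>
    (((AlgebraicTopology.singularHomologyFunctor.{u} (ModuleCat.{max u v} R) n).obj
      (ModuleCat.of R (ULift.{u} R))).map (TopCat.ofHom f.realization)).hom

/-- The relation `α ↗ β` (`α` points to `β`). -/
def PointsTo (R : Type v) [CommRing R] (P : PrecubicalSet.{u}) (α β : P.TotalHomology R) : Prop :=
  ∃ X Y : P.Subset,
    α ∈ LinearMap.range (X.incl.homologyMap R) ∧ β ∈ LinearMap.range (Y.incl.homologyMap R) ∧
      ∀ x ∈ X.carrier 0, ∀ y ∈ Y.carrier 0, P.Accessible x y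

/-- The homology graph of `P`: its vertices are the homology classes of `|P|`, and its edges are
given by the relation `↗`. -/
def homologyGraph (R : Type v) [CommRing R] (P : PrecubicalSet.{u}) :
    Digraph (P.TotalHomology R) where
  Adj := P.PointsTo R

end

end PrecubicalSet

/-! By regularity, the cubes of star(v) are exactly the faces of `x` through the corner `k`, that
is, the words without a letter `!k i`. Choose any direction `j`. The map `push` moves the cube
[0,1]^n onto the union of the faces opposite to `k`, keeping that union pointwise fixed. Applied to
the cubes of star(v) and extended by the identity elsewhere, it gives a strong deformation
retraction of |P| onto |Q|. Hence the inclusion is a homotopy equivalence and ι_* is bijective.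

That ι_* preserves ↗ is formal: take images of subsets and paths. For the converse, let X and Y
witness ι_*(α) ↗ ι_*(β). Simply intersecting X with Q may lose the class, since the deformation need
not preserve |X|. It does preserve the faces of `x` that contain the direction `j` and pass through
`k`. So X is first enlarged to `sweep x X j (k j)`, in which every cube of star(v) is contained in
one that extends in the direction `j`; intersecting the sweep with Q is then a homotopy equivalence
(`exists_homotopyEquiv_sweep`).

The sweep adds only vertices joined by an edge to a vertex of X. The edge leads into X if `k j` is
1, and out of X if `k j` is 0. Therefore X is swept in a direction with letter 1 and Y in a
direction with letter 0, and every vertex of the first sweep still reaches every vertex of the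
second. Finally, a path in P between vertices of Q can be rerouted around v: it enters and leaves v
along edges of `x` in different directions, and these span a square whose other two sides avoid v
(`reroute`).

The topological input is that precubical subsets have closed embedded realizations, which follows
from unique normal forms of points. -/

namespace PrecubicalSet

/-! ### Words -/

/-- The endpoint of the unit interval that corresponds to a letter `0` or `1`. -/
def endpoint (b : Bool) : I := if b then 1 else 0

/-- The letters of a word, where `none` stands for the letter `[0,1]`. -/
def CubeWord.letter : ∀ {n m : ℕ}, CubeWord n m → Fin n → Option Bool
  | _, _, .nil => Fin.elim0
  | _, _, .vert k w => Fin.cons (α := fun _ => Option Bool) (some k) w.letter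
  | _, _, .edge w => Fin.cons (α := fun _ => Option Bool) none w.letter

/-- The affine embedding of `[0,1]^m` onto the face of `[0,1]^n` that belongs to a word. -/
def CubeWord.emb : ∀ {n m : ℕ}, CubeWord n m → (Fin m → I) → Fin n → I
  | _, _, .nil, t => t
  | _, _, .vert k w, t => Fin.cons (α := fun _ => I) (endpoint k) (w.emb t)
  | _, _, .edge w, t => Fin.cons (α := fun _ => I) (t 0) (w.emb (Fin.tail t))

theorem cons_coface {n : ℕ} (a : I) (b : Bool) (i : Fin (n + 1)) (t : Fin n → I) :
    (Fin.cons a (coface b i t) : Fin (n + 2) → I) =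
      coface b i.succ (Fin.cons a t : Fin (n + 1) → I) := by
  simp [coface, Fin.insertNth_succ_cons]

theorem coface_zero {n : ℕ} (b : Bool) (t : Fin n → I) :
    coface b 0 t = Fin.cons (endpoint b) t := by
  simp [coface, endpoint]

theorem CubeWord.emb_face {n m : ℕ} (b : Bool) :
    ∀ (w : CubeWord n (m + 1)) (i : Fin (m + 1)) (t : Fin m → I),
      (w.face b i).emb t = w.emb (coface b i t)
  | .vert k w, i, t => by
      simp [CubeWord.emb, CubeWord.emb_face b w i t]
  | .edge w, i, t => by
      induction i using Fin.cases with
      | zero => simp [CubeWord.emb, coface_zero]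
      | succ i =>
        cases m with
        | zero => exact i.elim0
        | succ m =>
          have ht : coface b i.succ t =
              (Fin.cons (t 0) (coface b i (Fin.tail t)) : Fin (m + 2) → I) := by
            rw [cons_coface, Fin.cons_self_tail]
          rw [CubeWord.face_edge_succ, ht]
          simp [CubeWord.emb, CubeWord.emb_face b w i (Fin.tail t)]

theorem CubeWord.continuous_emb {n m : ℕ} (w : CubeWord n m) : Continuous w.emb := by
  induction w with
  | nil => exact continuous_id
  | vert k w ih =>
    simp only [CubeWord.emb]
    fun_prop
  | edge w ih =>
    simp only [CubeWord.emb]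
    refine Continuous.finCons (continuous_apply 0) (ih.comp ?_)
    exact continuous_pi fun i => continuous_apply _

theorem CubeWord.emb_eq_endpoint {n m : ℕ} (w : CubeWord n m) (t : Fin m → I) {i : Fin n}
    {b : Bool} (h : w.letter i = some b) : w.emb t i = endpoint b := by
  induction w with
  | nil => exact i.elim0
  | vert k w ih =>
    induction i using Fin.cases with
    | zero =>
      obtain rfl : k = b := by simpa [CubeWord.letter] using h
      simp [CubeWord.emb]
    | succ i => exact ih t h
  | edge w ih =>
    induction i using Fin.cases with
    | zero => simp [CubeWord.letter] at h
    | succ i => exact ih _ h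

theorem CubeWord.exists_emb_eq {n m : ℕ} (w : CubeWord n m) (p : Fin n → I)
    (h : ∀ i b, w.letter i = some b → p i = endpoint b) : ∃ t, w.emb t = p := by
  induction w with
  | nil => exact ⟨p, rfl⟩
  | vert k w ih =>
    obtain ⟨t, ht⟩ := ih (Fin.tail p) fun i b hb => h i.succ b hb
    refine ⟨t, ?_⟩
    simp only [CubeWord.emb]
    rw [ht, ← h 0 k rfl, Fin.cons_self_tail]
  | edge w ih =>
    obtain ⟨t, ht⟩ := ih (Fin.tail p) fun i b hb => h i.succ b hb
    refine ⟨(Fin.cons (p 0) t), ?_⟩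
    simp only [CubeWord.emb, Fin.tail_cons, Fin.cons_zero]
    rw [ht, Fin.cons_self_tail]

theorem CubeWord.letter_ne_none {n : ℕ} (w : CubeWord n 0) (i : Fin n) : w.letter i ≠ none := by
  generalize hm : 0 = m at w
  induction w with
  | nil => exact i.elim0
  | vert k w ih =>
    induction i using Fin.cases with
    | zero => simp [CubeWord.letter]
    | succ i => exact ih i hm
  | edge w ih => omega

/-- Faces count the occurrences of [0,1], letters count all places. The place `j` is the same for
both values of `b`; the next lemma but one gives the translation in the other direction. -/
theorem CubeWord.exists_letter_face {n m : ℕ} : ∀ (w : CubeWord n (m + 1)) (i : Fin (m + 1)),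
    ∃ j, w.letter j = none ∧
      ∀ b, (w.face b i).letter = Function.update w.letter j (some b)
  | .vert k w, i => by
      obtain ⟨j, hj, h⟩ := w.exists_letter_face i
      refine ⟨j.succ, hj, fun b => ?_⟩
      rw [CubeWord.face_vert]
      simp only [CubeWord.letter]
      rw [h b, Fin.cons_update]
  | .edge w, i => by
      induction i using Fin.cases with
      | zero =>
        refine ⟨0, rfl, fun b => ?_⟩
        rw [CubeWord.face_edge_zero]
        simp only [CubeWord.letter]
        rw [Fin.update_cons_zero]
      | succ i =>
        cases m with
        | zero => exact i.elim0
        | succ m =>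
          obtain ⟨j, hj, h⟩ := w.exists_letter_face i
          refine ⟨j.succ, hj, fun b => ?_⟩
          rw [CubeWord.face_edge_succ]
          simp only [CubeWord.letter]
          rw [h b, Fin.cons_update]

theorem CubeWord.exists_face_of_letter_eq_none {n m : ℕ} : ∀ (w : CubeWord n (m + 1)) {j : Fin n},
    w.letter j = none → ∃ i, ∀ b, (w.face b i).letter = Function.update w.letter j (some b)
  | .vert k w, j, hj => by
      induction j using Fin.cases with
      | zero => simp [CubeWord.letter] at hj
      | succ j =>
        obtain ⟨i, h⟩ := w.exists_face_of_letter_eq_none (j := j) hj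
        refine ⟨i, fun b => ?_⟩
        rw [CubeWord.face_vert]
        simp only [CubeWord.letter]
        rw [h b, Fin.cons_update]
  | .edge w, j, hj => by
      induction j using Fin.cases with
      | zero =>
        refine ⟨0, fun b => ?_⟩
        rw [CubeWord.face_edge_zero]
        simp only [CubeWord.letter]
        rw [Fin.update_cons_zero]
      | succ j =>
        cases m with
        | zero => exact absurd hj (w.letter_ne_none j)
        | succ m =>
          obtain ⟨i, h⟩ := w.exists_face_of_letter_eq_none (j := j) hj
          refine ⟨i.succ, fun b => ?_⟩
          rw [CubeWord.face_edge_succ]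
          simp only [CubeWord.letter]
          rw [h b, Fin.cons_update]

/-- The letters determine the degree as well, so the equality is one of pairs. This is also what
makes the set of all faces of a cube finite. -/
theorem CubeWord.sigma_eq_of_letter_eq {n m m' : ℕ} (w : CubeWord n m) (w' : CubeWord n m')
    (h : w.letter = w'.letter) : (⟨m, w⟩ : Σ m, CubeWord n m) = ⟨m', w'⟩ := by
  induction w generalizing m' with
  | nil => cases w'; rfl
  | vert k w ih =>
    cases w' with
    | vert k' w' =>
      simp only [CubeWord.letter, Fin.cons_inj, Option.some.injEq] at h
      obtain ⟨rfl, h⟩ := h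
      cases ih w' h
      rfl
    | edge w' => simp [CubeWord.letter, Fin.cons_inj] at h
  | edge w ih =>
    cases w' with
    | vert k' w' => simp [CubeWord.letter, Fin.cons_inj] at h
    | edge w' =>
      simp only [CubeWord.letter, Fin.cons_inj, true_and] at h
      cases ih w' h
      rfl

theorem CubeWord.letter_injective {n m : ℕ} :
    Function.Injective (CubeWord.letter : CubeWord n m → _) := fun w w' h => by
  simpa using w.sigma_eq_of_letter_eq w' h

instance (n : ℕ) : Finite (Σ m, CubeWord n m) :=
  Finite.of_injective (fun w => w.2.letter) fun w w' h => w.2.sigma_eq_of_letter_eq w'.2 h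

theorem CubeWord.exists_letter_eq {n : ℕ} (l : Fin n → Option Bool) :
    ∃ (m : ℕ) (w : CubeWord n m), w.letter = l := by
  induction n with
  | zero => exact ⟨0, .nil, funext fun i => i.elim0⟩
  | succ n ih =>
    obtain ⟨m, w, h⟩ := ih (Fin.tail l)
    rcases h0 : l 0 with _ | b
    · refine ⟨_, .edge w, ?_⟩
      simp only [CubeWord.letter]
      rw [h, ← h0, Fin.cons_self_tail]
    · refine ⟨_, .vert b w, ?_⟩
      simp only [CubeWord.letter]
      rw [h, ← h0, Fin.cons_self_tail]

/-! ### Points of the realization -/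

/-- The point of `|P|` that has the coordinates `t` in the cube `x`. -/
def mkPoint (P : PrecubicalSet.{u}) {n : ℕ} (x : P.cube n) (t : Fin n → I) : P.Realization :=
  Quot.mk _ ⟨⟨n, x⟩, t⟩

theorem continuous_mkPoint (P : PrecubicalSet.{u}) {n : ℕ} (x : P.cube n) :
    Continuous (P.mkPoint x) :=
  continuous_quot_mk.comp
    (@continuous_sigmaMk (Σ n : ℕ, P.cube n) (fun c => (Fin c.1 → I)) _ ⟨n, x⟩)

theorem mkPoint_face (P : PrecubicalSet.{u}) {n : ℕ} (k : Bool) (i : Fin (n + 1))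
    (x : P.cube (n + 1)) (t : Fin n → I) :
    P.mkPoint (P.face k i x) t = P.mkPoint x (coface k i t) :=
  Quot.sound (Glue.mk k i x t)

/-- The map `|shift P| → |P|` that adds a first coordinate `a`. -/
def unshift (P : PrecubicalSet.{u}) (a : I) : P.shift.Realization → P.Realization :=
  Quot.lift (fun p => P.mkPoint (n := p.1.1 + 1) p.1.2 (Fin.cons a p.2)) (by
    rintro _ _ ⟨k, i, x, t⟩
    exact (P.mkPoint_face k i.succ x _).trans (congrArg (P.mkPoint _) (cons_coface _ _ _ _).symm))

theorem mkPoint_sharpFun {n m : ℕ} (w : CubeWord n m) : ∀ (P : PrecubicalSet.{u}) (x : P.cube n)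
    (t : Fin m → I), P.mkPoint (sharpFun P x w) t = P.mkPoint x (w.emb t) := by
  induction w with
  | nil => intro P x t; rfl
  | vert k w ih =>
    intro P x t
    simp only [sharpFun, CubeWord.emb]
    rw [ih, mkPoint_face, coface_zero]
  | edge w ih =>
    intro P x t
    simp only [sharpFun, CubeWord.emb]
    -- The induction hypothesis concerns `P.shift`; the free first coordinate is restored by
    -- `unshift`.
    have := congrArg (P.unshift (t 0)) (ih P.shift x (Fin.tail t))
    refine Eq.trans ?_ this
    change _ = P.mkPoint (n := _ + 1) _ (Fin.cons (t 0) (Fin.tail t))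
    rw [Fin.cons_self_tail]

/-! ### Normal forms -/

/-- Adding a first coordinate `a` to a representative of a point of `|shift P|`. -/
def PreRealization.unshift {P : PrecubicalSet.{u}} (a : I) (p : P.shift.PreRealization) :
    P.PreRealization :=
  ⟨⟨p.1.1 + 1, p.1.2⟩, Fin.cons a p.2⟩

open Classical in
/-- The representative of the point `(x, t)` whose coordinates all lie in the open interval. -/
noncomputable def normalForm : ∀ {n : ℕ} (P : PrecubicalSet.{u}), P.cube n → (Fin n → I) →
    P.PreRealization
  | 0, _, x, t => ⟨⟨0, x⟩, t⟩
  | _ + 1, P, x, t =>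
    if t 0 = 0 then normalForm P (P.face false 0 x) (Fin.tail t)
    else if t 0 = 1 then normalForm P (P.face true 0 x) (Fin.tail t)
    else PreRealization.unshift (t 0) (normalForm P.shift x (Fin.tail t))

theorem normalForm_cons_endpoint {n : ℕ} (P : PrecubicalSet.{u}) (x : P.cube (n + 1)) (b : Bool)
    (t : Fin n → I) :
    normalForm P x (Fin.cons (endpoint b) t) = normalForm P (P.face b 0 x) t := by
  cases b <;> simp [normalForm, endpoint]

theorem normalForm_cons_of_ne {n : ℕ} (P : PrecubicalSet.{u}) (x : P.cube (n + 1)) {a : I}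
    (ha : ∀ b, a ≠ endpoint b) (t : Fin n → I) :
    normalForm P x (Fin.cons a t) = PreRealization.unshift a (normalForm P.shift x t) := by
  have h0 : a ≠ 0 := ha false
  have h1 : a ≠ 1 := ha true
  simp [normalForm, h0, h1]

/-- Normal forms are constant on the gluing classes. The recursion treats the first coordinate
first, so a face in a later place has to be commuted past it: by the cubical identity if that
coordinate is an endpoint, and inside `P.shift` otherwise. -/
theorem normalForm_face {n : ℕ} : ∀ (P : PrecubicalSet.{u}) (k : Bool) (i : Fin (n + 1))
    (x : P.cube (n + 1)) (t : Fin n → I),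
    normalForm P (P.face k i x) t = normalForm P x (coface k i t) := by
  induction n with
  | zero =>
    intro P k i x t
    obtain rfl : i = 0 := Fin.ext (by omega)
    rw [coface_zero, normalForm_cons_endpoint]
  | succ n ih =>
    intro P k i x t
    induction i using Fin.cases with
    | zero => rw [coface_zero, normalForm_cons_endpoint]
    | succ i =>
      rw [← Fin.cons_self_tail t, ← cons_coface]
      by_cases h : ∃ b, t 0 = endpoint b
      · obtain ⟨b, h⟩ := h
        rw [h, normalForm_cons_endpoint, normalForm_cons_endpoint, ← ih]
        exact congrArg (fun z => normalForm P z _) (P.face_face b k 0 i (Fin.zero_le _) x)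
      · push Not at h
        rw [normalForm_cons_of_ne P _ h, normalForm_cons_of_ne P _ h]
        exact congrArg (PreRealization.unshift (t 0)) (ih P.shift k i x (Fin.tail t))

theorem exists_normalForm_eq {n : ℕ} : ∀ (P : PrecubicalSet.{u}) (x : P.cube n) (t : Fin n → I),
    ∃ (m : ℕ) (w : CubeWord n m) (s : Fin m → I), w.emb s = t ∧
      normalForm P x t = ⟨⟨m, sharpFun P x w⟩, s⟩ := by
  induction n with
  | zero => exact fun P x t => ⟨0, .nil, t, rfl, rfl⟩
  | succ n ih =>
    intro P x t
    rw [← Fin.cons_self_tail t]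
    by_cases h : ∃ b, t 0 = endpoint b
    · obtain ⟨b, h⟩ := h
      obtain ⟨m, w, s, hs, hw⟩ := ih P (P.face b 0 x) (Fin.tail t)
      refine ⟨m, .vert b w, s, ?_, ?_⟩
      · simp only [CubeWord.emb]
        rw [hs, h]
      · rw [h, normalForm_cons_endpoint, hw]
        rfl
    · push Not at h
      obtain ⟨m, w, s, hs, hw⟩ := ih P.shift x (Fin.tail t)
      refine ⟨m + 1, .edge w, Fin.cons (t 0) s, ?_, ?_⟩
      · simp only [CubeWord.emb, Fin.tail_cons, Fin.cons_zero]
        rw [hs]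
      · rw [normalForm_cons_of_ne P _ h, hw]
        rfl

/-- The normal form of a point of `|P|`. -/
noncomputable def Realization.normalForm {P : PrecubicalSet.{u}} :
    P.Realization → P.PreRealization :=
  Quot.lift (fun p => PrecubicalSet.normalForm P p.1.2 p.2) (by
    rintro _ _ ⟨k, i, x, t⟩
    exact normalForm_face P k i x t)

theorem Realization.mk_normalForm {P : PrecubicalSet.{u}} (a : P.Realization) :
    Quot.mk _ a.normalForm = a := by
  obtain ⟨⟨⟨n, x⟩, t⟩, rfl⟩ := Quot.exists_rep a
  obtain ⟨m, w, s, hs, hw⟩ := exists_normalForm_eq P x t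
  refine (congrArg (Quot.mk _) hw).trans ?_
  exact (mkPoint_sharpFun w P x s).trans (congrArg (P.mkPoint x) hs)

/-- The map of representatives induced by a morphism. -/
def Hom.preMap {P : PrecubicalSet.{u}} {Q : PrecubicalSet.{v}} (f : Hom P Q)
    (p : P.PreRealization) : Q.PreRealization :=
  ⟨⟨p.1.1, f.app _ p.1.2⟩, p.2⟩

/-- The morphism of shifted precubical sets induced by a morphism. -/
def Hom.shift {P : PrecubicalSet.{u}} {Q : PrecubicalSet.{v}} (f : Hom P Q) :
    Hom P.shift Q.shift where
  app n := f.app (n + 1)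
  app_face k i x := f.app_face k i.succ x

theorem Hom.normalForm_app {n : ℕ} : ∀ {P : PrecubicalSet.{u}} {Q : PrecubicalSet.{v}}
    (f : Hom P Q) (x : P.cube n) (t : Fin n → I),
    PrecubicalSet.normalForm Q (f.app n x) t = f.preMap (PrecubicalSet.normalForm P x t) := by
  induction n with
  | zero => exact fun f x t => rfl
  | succ n ih =>
    intro P Q f x t
    rw [← Fin.cons_self_tail t]
    by_cases h : ∃ b, t 0 = endpoint b
    · obtain ⟨b, h⟩ := h
      rw [h, normalForm_cons_endpoint, normalForm_cons_endpoint, ← ih, f.app_face]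
    · push Not at h
      rw [normalForm_cons_of_ne _ _ h, normalForm_cons_of_ne _ _ h]
      exact congrArg (PreRealization.unshift (t 0)) (ih f.shift x (Fin.tail t))

theorem Hom.normalForm_realization {P : PrecubicalSet.{u}} {Q : PrecubicalSet.{v}}
    (f : Hom P Q) (a : P.Realization) :
    (f.realization a).normalForm = f.preMap a.normalForm := by
  obtain ⟨⟨⟨n, x⟩, t⟩, rfl⟩ := Quot.exists_rep a
  exact f.normalForm_app x t

theorem Subset.exists_of_preMap_incl_eq {P : PrecubicalSet.{u}} (X : P.Subset)
    (q : X.toPrecubicalSet.PreRealization) {m : ℕ} {y : P.cube m} {s : Fin m → I}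
    (h : X.incl.preMap q = ⟨⟨m, y⟩, s⟩) :
    ∃ hy : y ∈ X.carrier m, q = ⟨⟨m, ⟨y, hy⟩⟩, s⟩ := by
  obtain ⟨⟨m', z, hz⟩, s'⟩ := q
  cases h
  exact ⟨hz, rfl⟩

/-! ### The realization of a precubical subset -/

/-- Normal forms are natural, and the inclusion is injective on representatives. -/
theorem Subset.injective_incl_realization {P : PrecubicalSet.{u}} (X : P.Subset) :
    Function.Injective X.incl.realization := by
  intro a b h
  have h' := congrArg Realization.normalForm h
  rw [Hom.normalForm_realization, Hom.normalForm_realization] at h'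
  obtain ⟨hy, hq⟩ := X.exists_of_preMap_incl_eq a.normalForm h'
  rw [← a.mk_normalForm, ← b.mk_normalForm, hq]
  rfl

theorem Subset.isClosedMap_incl_realization {P : PrecubicalSet.{u}} (X : P.Subset) :
    IsClosedMap X.incl.realization := by
  intro C hC
  refine (isQuotientMap_quot_mk (r := P.Glue)).isClosed_preimage.1 ?_
  refine isClosed_sigma_iff.2 fun c => ?_
  obtain ⟨n, y⟩ := c
  -- By normal forms, a point of the cube `y` comes from C exactly if it lies on some face of `y`
  -- that belongs to X, at a position belonging to C. There are finitely many faces, and each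
  -- contributes a compact set.
  have key : (Sigma.mk (⟨n, y⟩ : Σ n : ℕ, P.cube n) ⁻¹' (Quot.mk P.Glue ⁻¹'
      (X.incl.realization '' C))) =
      ⋃ w : Σ m, CubeWord n m, ⋃ h : sharpFun P y w.2 ∈ X.carrier w.1,
        w.2.emb '' (X.toPrecubicalSet.mkPoint (⟨sharpFun P y w.2, h⟩ : X.carrier w.1) ⁻¹' C) := by
    ext t
    simp only [Set.mem_preimage, Set.mem_iUnion, Set.mem_image]
    constructor
    · rintro ⟨c, hc, hct⟩
      have hn := congrArg Realization.normalForm hct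
      rw [Hom.normalForm_realization] at hn
      obtain ⟨m, w, s, hs, hw⟩ := exists_normalForm_eq P y t
      obtain ⟨hy, hq⟩ := X.exists_of_preMap_incl_eq c.normalForm (hn.trans hw)
      refine ⟨⟨m, w⟩, hy, s, ?_, hs⟩
      rw [← c.mk_normalForm, hq] at hc
      exact hc
    · rintro ⟨⟨m, w⟩, h, s, hs, rfl⟩
      exact ⟨_, hs, mkPoint_sharpFun w P y s⟩
  refine (congrArg IsClosed key).mpr ?_
  refine isClosed_iUnion_of_finite fun w => isClosed_iUnion_of_finite fun h => ?_
  exact (((hC.preimage (continuous_mkPoint _ _)).isCompact).image w.2.continuous_emb).isClosed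

theorem Subset.isClosedEmbedding_incl_realization {P : PrecubicalSet.{u}} (X : P.Subset) :
    Topology.IsClosedEmbedding X.incl.realization :=
  .of_continuous_injective_isClosedMap X.incl.realization.continuous
    X.injective_incl_realization X.isClosedMap_incl_realization

end PrecubicalSet

/-! ### Deformations of embedded subspaces -/

/-- One ambient deformation H of Z serves for every pair B ⊆ A that it respects: A is kept inside A,
ends in B, and B does not move. Because both spaces are embedded, the retraction and the homotopy
can be lifted from Z continuously. -/
theorem exists_homotopyEquiv_of_deformation {Z A B : Type*} [TopologicalSpace Z]
    [TopologicalSpace A] [TopologicalSpace B] {f : C(A, Z)} (hf : Topology.IsEmbedding f)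
    {g : C(B, Z)} (hg : Topology.IsEmbedding g) (i : C(B, A)) (hi : ∀ b, f (i b) = g b)
    (H : C(Z × I, Z)) (h_zero : ∀ z, H (z, 0) = z)
    (h_range : ∀ a s, H (f a, s) ∈ Set.range f) (h_one : ∀ a, H (f a, 1) ∈ Set.range g)
    (h_fix : ∀ b s, H (g b, s) = g b) :
    ∃ e : ContinuousMap.HomotopyEquiv B A, e.toFun = i := by
  choose r hr using h_one
  choose K hK using h_range
  have hr_cont : Continuous r := hg.continuous_iff.2 <| by
    have : (g ∘ r) = fun a => H (f a, 1) := funext hr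
    rw [this]
    fun_prop
  have hK_cont : Continuous fun p : I × A => K p.2 p.1 := hf.continuous_iff.2 <| by
    have : (f ∘ fun p : I × A => K p.2 p.1) = fun p => H (f p.2, p.1) :=
      funext fun p => hK p.2 p.1
    rw [this]
    fun_prop
  have hri : ∀ b, r (i b) = b := fun b => hg.injective <| by rw [hr, hi, h_fix]
  have hid : (⟨r, hr_cont⟩ : C(A, B)).comp i = ContinuousMap.id B := ContinuousMap.ext hri
  refine ⟨⟨i, ⟨r, hr_cont⟩, ?_, ?_⟩, rfl⟩
  · rw [hid]
  · refine ContinuousMap.Homotopic.symm ⟨⟨⟨fun p => K p.2 p.1, hK_cont⟩, fun a => ?_, fun a => ?_⟩⟩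
    · exact hf.injective ((hK a 0).trans (h_zero _))
    · exact hf.injective ((hK a 1).trans ((hr a).symm.trans (hi _).symm))

namespace PrecubicalSet

/-! ### The deformation of the cube away from a corner -/

/-- The reflection of the unit interval that moves the endpoint `b` to `0`. -/
def reflect (b : Bool) (a : I) : I := if b then σ a else a

theorem reflect_reflect (b : Bool) (a : I) : reflect b (reflect b a) = a := by
  cases b <;> simp [reflect]

theorem reflect_zero (b : Bool) : reflect b 0 = endpoint b := by
  cases b <;> simp [reflect, endpoint]

theorem reflect_one (b : Bool) : reflect b 1 = endpoint (!b) := by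
  cases b <;> simp [reflect, endpoint]

theorem continuous_reflect (b : Bool) : Continuous (reflect b) := by
  cases b
  · exact continuous_id
  · exact unitInterval.continuous_symm

/-- The distance of a point of the cube from the corner `k` with respect to the maximum norm. -/
def cornerDist {n : ℕ} (k : Fin n → Bool) (p : Fin n → I) : I :=
  Finset.univ.sup fun i => reflect (k i) (p i)

/-- A deformation of the cube onto the union of the faces that do not contain the corner `k`. The
faces that contain the edge from `k` in the direction `j` are preserved. -/
noncomputable def push {n : ℕ} (j : Fin n) (k : Fin n → Bool) (s : I) (p : Fin n → I) :
    Fin n → I := fun i =>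
  reflect (k i) (Set.projIcc (0 : ℝ) 1 zero_le_one (reflect (k i) (p i) +
    2 * s * (1 - cornerDist k p) * (if i = j then 1 else reflect (k i) (p i))))

section push

variable {n : ℕ} (j : Fin n) (k : Fin n → Bool)

theorem continuous_cornerDist : Continuous (cornerDist k) :=
  Continuous.finset_sup_apply fun i _ => (continuous_reflect _).comp (continuous_apply i)

theorem continuous_push : Continuous fun q : (Fin n → I) × I => push j k q.2 q.1 := by
  refine continuous_pi fun i => (continuous_reflect _).comp (continuous_projIcc.comp ?_)
  have h1 : Continuous fun q : (Fin n → I) × I => (reflect (k i) (q.1 i) : ℝ) :=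
    continuous_subtype_val.comp ((continuous_reflect _).comp (by fun_prop))
  have h2 : Continuous fun q : (Fin n → I) × I => (cornerDist k q.1 : ℝ) :=
    continuous_subtype_val.comp ((continuous_cornerDist k).comp continuous_fst)
  split_ifs <;> fun_prop

theorem push_zero (p : Fin n → I) : push j k 0 p = p := by
  funext i
  simp [push, reflect_reflect]

theorem reflect_le_cornerDist (p : Fin n → I) (i : Fin n) :
    reflect (k i) (p i) ≤ cornerDist k p :=
  Finset.le_sup (f := fun i => reflect (k i) (p i)) (Finset.mem_univ i)

/-- On a face opposite to the corner the distance is 1, so the factor `1 - cornerDist k p` stops the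
motion. -/
theorem push_eq_self {p : Fin n → I} {i : Fin n} (hp : p i = endpoint (!k i)) (s : I) :
    push j k s p = p := by
  have h1 : cornerDist k p = 1 := by
    refine le_antisymm unitInterval.le_one' ?_
    have := reflect_le_cornerDist k p i
    rwa [hp, ← reflect_one, reflect_reflect] at this
  funext i
  simp [push, h1, reflect_reflect]

/-- Away from `j` the displacement is proportional to the coordinate itself, so a vanishing
(reflected) coordinate remains zero. Only the direction `j` moves the corner. -/
theorem push_apply_of_eq_endpoint {p : Fin n → I} {i : Fin n} (hij : i ≠ j)
    (hp : p i = endpoint (k i)) (s : I) : push j k s p i = endpoint (k i) := by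
  have h1 : reflect (k i) (p i) = 0 := by rw [hp, ← reflect_zero, reflect_reflect]
  simp [push, h1, hij, reflect_zero]

/-- Let d be the distance from the corner. If d ≥ 1/2, a largest coordinate reaches 1: for a place
other than `j` this is d + 2(1 - d)d ≥ 1, i.e., (2d - 1)(1 - d) ≥ 0, and for `j` it is d + 2(1 - d)
≥ 1. If d ≤ 1/2, the displacement 2(1 - d) in the direction `j` is already at least 1. -/
theorem exists_push_one_eq (p : Fin n → I) : ∃ i, push j k 1 p i = endpoint (!k i) := by
  suffices h : ∃ i, (1 : ℝ) ≤ reflect (k i) (p i) +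
      2 * (1 : I) * (1 - cornerDist k p) * (if i = j then 1 else reflect (k i) (p i)) by
    obtain ⟨i, hi⟩ := h
    refine ⟨i, ?_⟩
    rw [← reflect_one]
    simp only [push]
    rw [Set.projIcc_of_right_le _ hi]
    rfl
  obtain ⟨i, -, hi⟩ := Finset.exists_mem_eq_sup Finset.univ ⟨j, Finset.mem_univ j⟩
    fun i => reflect (k i) (p i)
  have hi : cornerDist k p = reflect (k i) (p i) := hi
  have hle := reflect_le_cornerDist k p j
  have hj : (0 : ℝ) ≤ reflect (k j) (p j) := (reflect (k j) (p j)).2.1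
  have hd : (cornerDist k p : ℝ) ≤ 1 := (cornerDist k p).2.2
  rcases le_total (1 / 2 : ℝ) (cornerDist k p) with h | h
  · refine ⟨i, ?_⟩
    rw [← hi]
    split_ifs
    · simp only [Set.Icc.coe_one]
      linarith
    · simp only [Set.Icc.coe_one]
      nlinarith
  · refine ⟨j, ?_⟩
    simp only [Set.Icc.coe_one, if_true]
    linarith

end push

/-! ### The star of a corner of a regular cube -/

theorem Subset.sharpFun_mem {P : PrecubicalSet.{u}} (X : P.Subset) {n m : ℕ} {y : P.cube n}
    (hy : y ∈ X.carrier n) (w : CubeWord n m) : sharpFun P y w ∈ X.carrier m := by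
  have := Hom.app_sharpFun w X.incl (⟨y, hy⟩ : X.carrier n)
  exact this ▸ (sharpFun X.toPrecubicalSet (⟨y, hy⟩ : X.carrier n) w : X.carrier m).2

theorem sharpFun_sharpFun {P : PrecubicalSet.{u}} {n m l : ℕ} (x : P.cube n) (w : CubeWord n m)
    (w' : CubeWord m l) :
    sharpFun P (sharpFun P x w) w' = sharpFun P x (sharpFun (stdCube n) w w') :=
  (Hom.app_sharpFun w' (P.sharp x) w).symm

/-- The face of the standard cube on which the `i`-th coordinate is `b`. -/
def faceSubset {n : ℕ} (i : Fin n) (b : Bool) : (stdCube n).Subset where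
  carrier m := {w : CubeWord n m | w.letter i = some b}
  face_mem := by
    intro m c l w (hw : CubeWord.letter w i = some b)
    obtain ⟨j, hj, h⟩ := CubeWord.exists_letter_face w l
    change (CubeWord.face c l w).letter i = some b
    have hij : i ≠ j := by
      rintro rfl
      simp [hw] at hj
    rw [h, Function.update_of_ne hij, hw]

/-- The word of degree `0` with the letters `k`. -/
def CubeWord.vertex : ∀ {n : ℕ}, (Fin n → Bool) → CubeWord n 0
  | 0, _ => .nil
  | _ + 1, k => .vert (k 0) (CubeWord.vertex (Fin.tail k))

theorem CubeWord.letter_vertex {n : ℕ} (k : Fin n → Bool) :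
    (CubeWord.vertex k).letter = fun i => some (k i) := by
  induction n with
  | zero => exact funext fun i => i.elim0
  | succ n ih =>
    funext i
    induction i using Fin.cases with
    | zero => rfl
    | succ i => exact congrFun (ih (Fin.tail k)) i

theorem sharpFun_vertex {n : ℕ} (P : PrecubicalSet.{u}) (x : P.cube n) (k : Fin n → Bool) :
    sharpFun P x (CubeWord.vertex k) = P.corner x k := by
  induction n with
  | zero => rfl
  | succ n ih => exact ih _ _

theorem IsRegularCube.sharpFun_injective {P : PrecubicalSet.{u}} {n : ℕ} {x : P.cube n}
    (hx : P.IsRegularCube x) {m : ℕ} {w w' : CubeWord n m}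
    (h : sharpFun P x w = sharpFun P x w') : w = w' :=
  hx m h

theorem exists_sharpFun_eq {P : PrecubicalSet.{u}} {n m : ℕ} {x : P.cube n} {s : Set (P.cube m)}
    (h : s ⊆ Set.range ((P.sharp x).app m)) {y : P.cube m} (hy : y ∈ s) :
    ∃ w : CubeWord n m, sharpFun P x w = y :=
  h hy

/-- Filling the free letters with those of `k` one at a time leads down to the vertex itself; the
star is closed under passing from a face to a cube, since its complement is closed under faces. -/
theorem sharpFun_mem_star {P : PrecubicalSet.{u}} {n m : ℕ} (x : P.cube n) (k : Fin n → Bool)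
    (w : CubeWord n m) (h : ∀ i, w.letter i ≠ some (!k i)) :
    sharpFun P x w ∈ P.star (P.corner x k) m := by
  induction m with
  | zero =>
    refine ⟨CubeWord.nil, ?_⟩
    rw [← sharpFun_vertex]
    refine congrArg (sharpFun P x) (CubeWord.letter_injective ?_)
    rw [CubeWord.letter_vertex]
    funext i
    rcases hl : w.letter i with _ | b
    · exact absurd hl (w.letter_ne_none i)
    · have := h i
      rw [hl] at this
      revert this
      cases b <;> cases k i <;> simp
  | succ m ih =>
    obtain ⟨j, -, hw⟩ := w.exists_letter_face 0
    have hmem := ih (w.face (k j) 0) fun i => by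
      rw [hw]
      by_cases hij : i = j
      · subst hij
        simp
      · rw [Function.update_of_ne hij]
        exact h i
    by_contra hcon
    refine (P.starCompl (P.corner x k)).face_mem (k j) 0 hcon ?_
    exact (P.sharp x).app_face (k j) 0 w ▸ hmem

/-- Every face of a word keeps its letters 0 and 1, and by regularity the only word representing the
corner is `vertex k`. -/
theorem IsRegularCube.letter_ne_of_mem_star {P : PrecubicalSet.{u}} {n m : ℕ} {x : P.cube n}
    (hx : P.IsRegularCube x) {k : Fin n → Bool} {w : CubeWord n m}
    (h : sharpFun P x w ∈ P.star (P.corner x k) m) (i : Fin n) : w.letter i ≠ some (!k i) := by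
  intro hi
  obtain ⟨w', hw'⟩ := h
  have h1 : sharpFun P x (sharpFun (stdCube n) w w') = sharpFun P x (CubeWord.vertex k) := by
    rw [sharpFun_vertex]
    exact (sharpFun_sharpFun x w w').symm.trans hw'
  have h2 : (sharpFun (stdCube n) w w' : CubeWord n 0).letter i = some (!k i) :=
    (faceSubset i (!k i)).sharpFun_mem hi w'
  rw [hx.sharpFun_injective h1, CubeWord.letter_vertex] at h2
  simp at h2

/-! ### The deformation of the realization -/

theorem mkPoint_mem_range {P : PrecubicalSet.{u}} (X : P.Subset) {n : ℕ} {y : P.cube n}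
    (hy : y ∈ X.carrier n) (t : Fin n → I) : P.mkPoint y t ∈ Set.range X.incl.realization :=
  ⟨X.toPrecubicalSet.mkPoint (⟨y, hy⟩ : X.carrier n) t, rfl⟩

section deformation

variable {P : PrecubicalSet.{u}} {n : ℕ} (x : P.cube n) (k : Fin n → Bool) (j : Fin n)

open Classical in
/-- The deformation of `|P|` away from a corner of `x`, restricted to a cube `y`. -/
noncomputable def cubeDeform {m : ℕ} (y : P.cube m) (q : (Fin m → I) × I) : P.Realization :=
  if h : y ∈ P.star (P.corner x k) m ∧ ∃ w : CubeWord n m, sharpFun P x w = y then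
    P.mkPoint x (push j k q.2 (h.2.choose.emb q.1))
  else P.mkPoint y q.1

theorem continuous_cubeDeform {m : ℕ} (y : P.cube m) : Continuous (cubeDeform x k j y) := by
  by_cases h : y ∈ P.star (P.corner x k) m ∧ ∃ w : CubeWord n m, sharpFun P x w = y
  · have h1 : cubeDeform x k j y =
        P.mkPoint x ∘ (fun q => push j k q.2 q.1) ∘ Prod.map h.2.choose.emb id := by
      funext q
      exact dif_pos h
    rw [h1]
    exact (continuous_mkPoint P x).comp
      ((continuous_push j k).comp (h.2.choose.continuous_emb.prodMap continuous_id))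
  · have h1 : cubeDeform x k j y = P.mkPoint y ∘ Prod.fst := by
      funext q
      exact dif_neg h
    rw [h1]
    exact (continuous_mkPoint P y).comp continuous_fst

theorem cubeDeform_of_notMem {m : ℕ} {y : P.cube m} (hy : y ∉ P.star (P.corner x k) m)
    (q : (Fin m → I) × I) : cubeDeform x k j y q = P.mkPoint y q.1 := by
  simp [cubeDeform, hy]

variable {x}

/-- The formula holds for all faces of `x`, also those outside the star, because `push` fixes the
opposite faces. This makes the two cases of the definition agree under gluing. -/
theorem cubeDeform_sharpFun (hx : P.IsRegularCube x) {m : ℕ} (w : CubeWord n m)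
    (q : (Fin m → I) × I) :
    cubeDeform x k j (sharpFun P x w) q = P.mkPoint x (push j k q.2 (w.emb q.1)) := by
  by_cases hw : sharpFun P x w ∈ P.star (P.corner x k) m
  · have h : ∃ w' : CubeWord n m, sharpFun P x w' = sharpFun P x w := ⟨w, rfl⟩
    have hc : h.choose = w := hx.sharpFun_injective h.choose_spec
    simp only [cubeDeform, hw, h, and_self, dite_true, hc]
  · rw [cubeDeform_of_notMem x k j hw, mkPoint_sharpFun]
    have : ∃ i, w.letter i = some (!k i) := by
      by_contra hcon
      push Not at hcon
      exact hw (sharpFun_mem_star x k w hcon)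
    obtain ⟨i, hi⟩ := this
    rw [push_eq_self j k (w.emb_eq_endpoint _ hi)]

theorem cubeDeform_face (hx : P.IsRegularCube x)
    (hstar : ∀ m : ℕ, P.star (P.corner x k) m ⊆ Set.range ((P.sharp x).app m))
    {m : ℕ} (b : Bool) (i : Fin (m + 1)) (y : P.cube (m + 1)) (t : Fin m → I) (s : I) :
    cubeDeform x k j (P.face b i y) (t, s) = cubeDeform x k j y (coface b i t, s) := by
  by_cases hy : y ∈ P.star (P.corner x k) (m + 1)
  · obtain ⟨w, rfl⟩ := exists_sharpFun_eq (hstar _) hy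
    have h1 : P.face b i (sharpFun P x w) = sharpFun P x (CubeWord.face b i w) :=
      ((P.sharp x).app_face b i w).symm
    rw [h1, cubeDeform_sharpFun k j hx, cubeDeform_sharpFun k j hx, CubeWord.emb_face]
  · have hy' : P.face b i y ∉ P.star (P.corner x k) m :=
      (P.starCompl (P.corner x k)).face_mem b i hy
    rw [cubeDeform_of_notMem x k j hy, cubeDeform_of_notMem x k j hy', mkPoint_face]

theorem exists_deformation (hx : P.IsRegularCube x)
    (hstar : ∀ m : ℕ, P.star (P.corner x k) m ⊆ Set.range ((P.sharp x).app m)) :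
    ∃ H : C(P.Realization × I, P.Realization), ∀ (m : ℕ) (y : P.cube m) (t : Fin m → I) (s : I),
      H (P.mkPoint y t, s) = cubeDeform x k j y (t, s) := by
  -- The deformation is curried, so that only |P|, and not |P| × I, has to be treated as a quotient;
  -- uncurrying is continuous because I is locally compact.
  let F : P.PreRealization → C(I, P.Realization) := fun p =>
    ContinuousMap.curry ⟨cubeDeform x k j p.1.2, continuous_cubeDeform x k j p.1.2⟩ p.2
  have hF : ∀ p q, P.Glue p q → F p = F q := by
    rintro _ _ ⟨b, i, y, t⟩
    exact ContinuousMap.ext fun s => cubeDeform_face k j hx hstar b i y t s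
  have hF_cont : Continuous F := continuous_sigma fun c =>
    (ContinuousMap.curry ⟨cubeDeform x k j c.2, continuous_cubeDeform x k j c.2⟩).continuous
  let G : C(P.Realization, C(I, P.Realization)) :=
    ⟨Quot.lift F hF, continuous_quot_lift hF hF_cont⟩
  exact ⟨G.uncurry, fun m y t s => rfl⟩

theorem exists_mkPoint_eq (a : P.Realization) :
    ∃ (m : ℕ) (y : P.cube m) (t : Fin m → I), P.mkPoint y t = a := by
  obtain ⟨⟨⟨m, y⟩, t⟩, rfl⟩ := Quot.exists_rep a
  exact ⟨m, y, t, rfl⟩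

theorem exists_mkPoint_eq_incl (X : P.Subset) (a : X.toPrecubicalSet.Realization) :
    ∃ (m : ℕ) (y : P.cube m) (_ : y ∈ X.carrier m) (t : Fin m → I),
      P.mkPoint y t = X.incl.realization a := by
  obtain ⟨⟨⟨m, y⟩, t⟩, rfl⟩ := Quot.exists_rep a
  exact ⟨m, y.1, y.2, t, rfl⟩

theorem mkPoint_mem_range_starCompl (hx : P.IsRegularCube x) {p : Fin n → I} {i : Fin n}
    (hp : p i = endpoint (!k i)) :
    P.mkPoint x p ∈ Set.range (P.starCompl (P.corner x k)).incl.realization := by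
  obtain ⟨m, w, hw⟩ := CubeWord.exists_letter_eq
    (Function.update (fun _ => none : Fin n → Option Bool) i (some (!k i)))
  obtain ⟨t, rfl⟩ := w.exists_emb_eq p fun l b hl => by
    rw [hw] at hl
    by_cases h : l = i
    · subst h
      obtain rfl : (!k l) = b := by simpa using hl
      exact hp
    · simp [Function.update_of_ne h] at hl
  rw [← mkPoint_sharpFun]
  refine mkPoint_mem_range _ (fun hmem => ?_) t
  exact hx.letter_ne_of_mem_star hmem i (by rw [hw, Function.update_self])

theorem cubeDeform_one_mem_range (hx : P.IsRegularCube x)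
    (hstar : ∀ m : ℕ, P.star (P.corner x k) m ⊆ Set.range ((P.sharp x).app m))
    {m : ℕ} (y : P.cube m) (t : Fin m → I) :
    cubeDeform x k j y (t, 1) ∈ Set.range (P.starCompl (P.corner x k)).incl.realization := by
  by_cases hy : y ∈ P.star (P.corner x k) m
  · obtain ⟨w, rfl⟩ := exists_sharpFun_eq (hstar _) hy
    obtain ⟨i, hi⟩ := exists_push_one_eq j k (w.emb t)
    rw [cubeDeform_sharpFun k j hx]
    exact mkPoint_mem_range_starCompl k hx hi
  · rw [cubeDeform_of_notMem x k j hy]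
    exact mkPoint_mem_range _ hy t

theorem cubeDeform_zero (hx : P.IsRegularCube x)
    (hstar : ∀ m : ℕ, P.star (P.corner x k) m ⊆ Set.range ((P.sharp x).app m))
    {m : ℕ} (y : P.cube m) (t : Fin m → I) :
    cubeDeform x k j y (t, 0) = P.mkPoint y t := by
  by_cases hy : y ∈ P.star (P.corner x k) m
  · obtain ⟨w, rfl⟩ := exists_sharpFun_eq (hstar _) hy
    rw [cubeDeform_sharpFun k j hx, push_zero, ← mkPoint_sharpFun]
  · rw [cubeDeform_of_notMem x k j hy]

end deformation

/-! ### Operations on precubical subsets -/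

/-- The intersection of two precubical subsets. -/
def Subset.inter {P : PrecubicalSet.{u}} (X Y : P.Subset) : P.Subset where
  carrier n := X.carrier n ∩ Y.carrier n
  face_mem k i _ h := ⟨X.face_mem k i h.1, Y.face_mem k i h.2⟩

/-- The inclusion of a precubical subset in a larger one. -/
def Subset.inclusion {P : PrecubicalSet.{u}} {X Y : P.Subset}
    (h : ∀ n, X.carrier n ⊆ Y.carrier n) : Hom X.toPrecubicalSet Y.toPrecubicalSet where
  app n x := ⟨x.1, h n x.2⟩
  app_face _ _ _ := rfl

/-- The preimage of a precubical subset. -/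
def Subset.comap {P : PrecubicalSet.{u}} {Q : PrecubicalSet.{v}} (f : Hom P Q) (X : Q.Subset) :
    P.Subset where
  carrier n := f.app n ⁻¹' X.carrier n
  face_mem k i x h := by
    rw [Set.mem_preimage, f.app_face]
    exact X.face_mem k i h

/-- The image of a precubical subset. -/
def Subset.map {P : PrecubicalSet.{u}} {Q : PrecubicalSet.{v}} (f : Hom P Q) (X : P.Subset) :
    Q.Subset where
  carrier n := f.app n '' X.carrier n
  face_mem k i := by
    rintro _ ⟨x, h, rfl⟩
    exact ⟨_, X.face_mem k i h, f.app_face k i x⟩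

theorem mem_range_incl_realization_iff {P : PrecubicalSet.{u}} (X : P.Subset)
    (a : P.Realization) :
    a ∈ Set.range X.incl.realization ↔ a.normalForm.1.2 ∈ X.carrier a.normalForm.1.1 := by
  constructor
  · rintro ⟨b, rfl⟩
    rw [Hom.normalForm_realization]
    exact b.normalForm.1.2.2
  · intro h
    rw [← a.mk_normalForm]
    exact mkPoint_mem_range X h a.normalForm.2

/-! ### Homotopy equivalences -/

section homotopyEquiv

variable {P : PrecubicalSet.{u}} {n : ℕ} {x : P.cube n} (k : Fin n → Bool)

theorem exists_homotopyEquiv_starCompl (j : Fin n) (hx : P.IsRegularCube x)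
    (hstar : ∀ m : ℕ, P.star (P.corner x k) m ⊆ Set.range ((P.sharp x).app m)) :
    ∃ e : ContinuousMap.HomotopyEquiv
        (P.starCompl (P.corner x k)).toPrecubicalSet.Realization P.Realization,
      e.toFun = (P.starCompl (P.corner x k)).incl.realization := by
  obtain ⟨H, hH⟩ := exists_deformation k j hx hstar
  refine exists_homotopyEquiv_of_deformation (f := ContinuousMap.id _)
    Topology.IsEmbedding.id (Subset.isClosedEmbedding_incl_realization _).isEmbedding _
    (fun _ => rfl) H (fun a => ?_) (fun a s => ⟨_, rfl⟩) (fun a => ?_) (fun b s => ?_)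
  · obtain ⟨m, y, t, rfl⟩ := exists_mkPoint_eq a
    rw [hH, cubeDeform_zero k j hx hstar]
  · obtain ⟨m, y, t, rfl⟩ := exists_mkPoint_eq a
    rw [ContinuousMap.id_apply, hH]
    exact cubeDeform_one_mem_range k j hx hstar y t
  · obtain ⟨m, y, hy, t, hb⟩ := exists_mkPoint_eq_incl _ b
    rw [← hb, hH, cubeDeform_of_notMem x k j hy]

/-- The condition `hX` says that a cube of X in the star may be freed in the direction `j` without
leaving X. The deformation then stays in the freed face, as it preserves all coordinates `k i` with
i ≠ j. -/
theorem exists_homotopyEquiv_inter_starCompl (j : Fin n) (hx : P.IsRegularCube x)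
    (hstar : ∀ m : ℕ, P.star (P.corner x k) m ⊆ Set.range ((P.sharp x).app m)) (X : P.Subset)
    (hX : ∀ (m : ℕ) (w : CubeWord n m), sharpFun P x w ∈ X.carrier m →
      sharpFun P x w ∈ P.star (P.corner x k) m → ∃ (m' : ℕ) (w' : CubeWord n m'),
        w'.letter = Function.update w.letter j none ∧ sharpFun P x w' ∈ X.carrier m') :
    ∃ e : ContinuousMap.HomotopyEquiv
        (X.inter (P.starCompl (P.corner x k))).toPrecubicalSet.Realization
        X.toPrecubicalSet.Realization,
      e.toFun = (Subset.inclusion (X := X.inter (P.starCompl (P.corner x k))) (Y := X)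
        fun _ _ h => h.1).realization := by
  obtain ⟨H, hH⟩ := exists_deformation k j hx hstar
  have hrange : ∀ a s, H (X.incl.realization a, s) ∈ Set.range X.incl.realization := by
    intro a s
    obtain ⟨m, y, hyX, t, ha⟩ := exists_mkPoint_eq_incl _ a
    rw [← ha, hH]
    by_cases hy : y ∈ P.star (P.corner x k) m
    · obtain ⟨w, rfl⟩ := exists_sharpFun_eq (hstar _) hy
      obtain ⟨m', w', hw', hmem⟩ := hX m w hyX hy
      obtain ⟨t', ht'⟩ := w'.exists_emb_eq (push j k s (w.emb t)) fun i b hb => by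
        have hij : i ≠ j := by
          rintro rfl
          simp [hw'] at hb
        rw [hw', Function.update_of_ne hij] at hb
        obtain rfl : b = k i := by
          have := hx.letter_ne_of_mem_star hy i
          rw [hb] at this
          revert this
          cases b <;> cases k i <;> simp
        exact push_apply_of_eq_endpoint j k hij (w.emb_eq_endpoint t hb) s
      rw [cubeDeform_sharpFun k j hx, ← ht', ← mkPoint_sharpFun]
      exact mkPoint_mem_range X hmem t'
    · rw [cubeDeform_of_notMem x k j hy]
      exact mkPoint_mem_range X hyX t
  refine exists_homotopyEquiv_of_deformation
    X.isClosedEmbedding_incl_realization.isEmbedding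
    (g := (X.inter (P.starCompl (P.corner x k))).incl.realization)
    (Subset.isClosedEmbedding_incl_realization _).isEmbedding _ (fun b => ?_) H
    (fun a => ?_) hrange (fun a => ?_) (fun b s => ?_)
  · obtain ⟨p, rfl⟩ := Quot.exists_rep b
    rfl
  · obtain ⟨m, y, t, rfl⟩ := exists_mkPoint_eq a
    rw [hH, cubeDeform_zero k j hx hstar]
  -- Membership is read off the normal form, so the realization of an intersection is the
  -- intersection of the realizations.
  · rw [mem_range_incl_realization_iff]
    refine ⟨(mem_range_incl_realization_iff X _).1 (hrange a 1), ?_⟩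
    refine (mem_range_incl_realization_iff (P.starCompl (P.corner x k)) _).1 ?_
    obtain ⟨m, y, t, hy⟩ := exists_mkPoint_eq (X.incl.realization a)
    rw [← hy, hH]
    exact cubeDeform_one_mem_range k j hx hstar y t
  · obtain ⟨m, y, hy, t, hb⟩ := exists_mkPoint_eq_incl _ b
    rw [← hb, hH, cubeDeform_of_notMem x k j hy.2]

end homotopyEquiv

/-! ### Words of degree one -/

/-- The word of degree `1` with the letter `[0,1]` in the place `j` and the letters `k` elsewhere. -/
def CubeWord.line : ∀ {n : ℕ}, (Fin n → Bool) → Fin n → CubeWord n 1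
  | 0, _, j => j.elim0
  | _ + 1, k, j => Fin.cases (.edge (CubeWord.vertex (Fin.tail k)))
      (fun j => .vert (k 0) (CubeWord.line (Fin.tail k) j)) j

theorem CubeWord.face_line {n : ℕ} (k : Fin n → Bool) (j : Fin n) (b : Bool) :
    (CubeWord.line k j).face b 0 = CubeWord.vertex (Function.update k j b) := by
  induction n with
  | zero => exact j.elim0
  | succ n ih =>
    induction j using Fin.cases with
    | zero => simp [CubeWord.line, CubeWord.vertex]
    | succ j =>
      simp only [CubeWord.line, CubeWord.vertex, Fin.cases_succ, CubeWord.face_vert, ih]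
      rw [Fin.tail_update_succ, Function.update_of_ne (Fin.succ_ne_zero j).symm]

theorem CubeWord.exists_eq_vertex {n : ℕ} (w : CubeWord n 0) : ∃ k, w = CubeWord.vertex k := by
  have h : ∀ i, ∃ b, w.letter i = some b := fun i =>
    Option.ne_none_iff_exists'.1 (w.letter_ne_none i)
  choose k hk using h
  exact ⟨k, CubeWord.letter_injective (by rw [CubeWord.letter_vertex]; exact funext hk)⟩

theorem CubeWord.vertex_injective {n : ℕ} :
    Function.Injective (CubeWord.vertex : (Fin n → Bool) → CubeWord n 0) := fun k k' h => by
  have h := congrArg CubeWord.letter h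
  rw [CubeWord.letter_vertex, CubeWord.letter_vertex] at h
  exact funext fun i => Option.some_injective _ (congrFun h i)

theorem CubeWord.letter_line {n : ℕ} (k : Fin n → Bool) (j : Fin n) :
    (CubeWord.line k j).letter = Function.update (fun i => some (k i)) j none := by
  obtain ⟨i, hi, h⟩ := (CubeWord.line k j).exists_letter_face 0
  have hb : ∀ b, Function.update (CubeWord.line k j).letter i (some b) =
      fun l => some (Function.update k j b l) := fun b => by
    rw [← h, CubeWord.face_line, CubeWord.letter_vertex]
  obtain rfl : i = j := by
    -- If the free place `i` were not `j`, filling it with `!k i` would contradict the letter `k i`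
    -- of the resulting vertex.
    by_contra hij
    have h0 := congrFun (hb (!k i)) i
    simp [Function.update_of_ne hij] at h0
  funext l
  by_cases hl : l = i
  · subst hl
    rw [hi, Function.update_self]
  · have := congrFun (hb true) l
    rw [Function.update_of_ne hl, Function.update_of_ne hl] at this
    rw [Function.update_of_ne hl, this]

theorem CubeWord.exists_eq_line {n : ℕ} (w : CubeWord n 1) : ∃ k j, w = CubeWord.line k j := by
  obtain ⟨j, hj, h⟩ := w.exists_letter_face 0
  obtain ⟨k, hk⟩ := (w.face false 0).exists_eq_vertex
  refine ⟨k, j, CubeWord.letter_injective ?_⟩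
  have h := h false
  rw [hk, CubeWord.letter_vertex] at h
  rw [CubeWord.letter_line, h, Function.update_idem, ← hj, Function.update_eq_self]

/-! ### Paths -/

/-- The relation that two vertices are joined by an edge. -/
def Step (P : PrecubicalSet.{u}) (a b : P.cube 0) : Prop :=
  ∃ e : P.cube 1, P.face false 0 e = a ∧ P.face true 0 e = b

/-- The path of length `k` with the given vertices and edges. -/
def pathHom {P : PrecubicalSet.{u}} {k : ℕ} (p : Fin (k + 1) → P.cube 0) (e : Fin k → P.cube 1)
    (h0 : ∀ j, P.face false 0 (e j) = p j.castSucc) (h1 : ∀ j, P.face true 0 (e j) = p j.succ) :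
    Hom (interval k) P where
  app m := match m with
    | 0 => p
    | 1 => e
    | _ + 2 => fun y => Empty.elim y
  app_face {m} b i y := by
    match m with
    | 0 =>
      obtain rfl : i = 0 := Fin.ext (by omega)
      cases b
      · exact (h0 y).symm
      · exact (h1 y).symm
    | _ + 1 => exact Empty.elim y

theorem accessible_iff {P : PrecubicalSet.{u}} {a b : P.cube 0} :
    P.Accessible a b ↔ Relation.ReflTransGen P.Step a b := by
  constructor
  · rintro ⟨k, ω, rfl, rfl⟩
    have h : ∀ j : Fin (k + 1), Relation.ReflTransGen P.Step (ω.app 0 (0 : Fin (k + 1)))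
        (ω.app 0 j) := by
      intro j
      induction j using Fin.induction with
      | zero => exact .refl
      | succ j ih =>
        refine ih.tail ⟨ω.app 1 j, ?_, ?_⟩
        · exact (ω.app_face (n := 0) false 0 j).symm
        · exact (ω.app_face (n := 0) true 0 j).symm
    exact h _
  · intro h
    induction h with
    | refl =>
      exact ⟨0, pathHom (fun _ => a) (fun j => j.elim0) (fun j => j.elim0) (fun j => j.elim0),
        rfl, rfl⟩
    | @tail b c _ hbc ih =>
      obtain ⟨k, ω, h0, h1⟩ := ih
      obtain ⟨e, he0, he1⟩ := hbc
      let p : Fin (k + 1 + 1) → P.cube 0 :=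
        Fin.snoc (α := fun _ => P.cube 0) (fun j : Fin (k + 1) => ω.app 0 j) c
      let q : Fin (k + 1) → P.cube 1 :=
        Fin.snoc (α := fun _ => P.cube 1) (fun j : Fin k => ω.app 1 j) e
      refine ⟨k + 1, pathHom p q (fun j => ?_) (fun j => ?_), ?_, ?_⟩
      · induction j using Fin.lastCases with
        | last => simp only [p, q, Fin.snoc_last, Fin.snoc_castSucc]; exact he0.trans h1.symm
        | cast j =>
          simp only [p, q, Fin.snoc_castSucc]
          exact (ω.app_face (n := 0) false 0 j).symm
      · induction j using Fin.lastCases with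
        | last => simp only [p, q, Fin.snoc_last, Fin.succ_last]; exact he1
        | cast j =>
          simp only [p, q, Fin.snoc_castSucc, Fin.succ_castSucc]
          exact (ω.app_face (n := 0) true 0 j).symm
      · change p 0 = a
        rw [← h0]
        exact Fin.snoc_castSucc (α := fun _ => P.cube 0) _ _ (0 : Fin (k + 1))
      · exact Fin.snoc_last (α := fun _ => P.cube 0) _ _

theorem Step.map {P : PrecubicalSet.{u}} {Q : PrecubicalSet.{v}} (f : Hom P Q) {a b : P.cube 0}
    (h : P.Step a b) : Q.Step (f.app 0 a) (f.app 0 b) := by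
  obtain ⟨e, rfl, rfl⟩ := h
  exact ⟨f.app 1 e, (f.app_face _ _ e).symm, (f.app_face _ _ e).symm⟩

theorem Accessible.map {P : PrecubicalSet.{u}} {Q : PrecubicalSet.{v}} (f : Hom P Q)
    {a b : P.cube 0} (h : P.Accessible a b) : Q.Accessible (f.app 0 a) (f.app 0 b) :=
  accessible_iff.2 (Relation.ReflTransGen.lift (f.app 0) (fun _ _ => Step.map f) _ _ (accessible_iff.1 h))

theorem Accessible.trans {P : PrecubicalSet.{u}} {a b c : P.cube 0} (h : P.Accessible a b)
    (h' : P.Accessible b c) : P.Accessible a c :=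
  accessible_iff.2 ((accessible_iff.1 h).trans (accessible_iff.1 h'))

theorem mem_star_vertex {P : PrecubicalSet.{u}} {v a : P.cube 0} : a ∈ P.star v 0 ↔ v = a := by
  constructor
  · rintro ⟨w, rfl⟩
    cases w
    rfl
  · rintro rfl
    exact ⟨CubeWord.nil, rfl⟩

theorem mem_star_edge {P : PrecubicalSet.{u}} {v : P.cube 0} {e : P.cube 1} :
    e ∈ P.star v 1 ↔ ∃ b, P.face b 0 e = v := by
  constructor
  · rintro ⟨w, rfl⟩
    obtain ⟨b, w', hw⟩ : ∃ b w', w = CubeWord.vert b w' := by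
      rcases w with _ | ⟨b, w'⟩
      exact ⟨b, w', rfl⟩
    subst hw
    cases w'
    exact ⟨b, rfl⟩
  · rintro ⟨b, rfl⟩
    exact ⟨CubeWord.vert b CubeWord.nil, rfl⟩

section reroute

variable {P : PrecubicalSet.{u}} {n : ℕ} {x : P.cube n} {k : Fin n → Bool}

theorem face_sharpFun_line (x : P.cube n) (k : Fin n → Bool) (j : Fin n) (b : Bool) :
    P.face b 0 (sharpFun P x (CubeWord.line k j)) = P.corner x (Function.update k j b) := by
  rw [← sharpFun_vertex, ← CubeWord.face_line]
  exact ((P.sharp x).app_face b 0 (CubeWord.line k j)).symm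

theorem IsRegularCube.corner_injective (hx : P.IsRegularCube x) :
    Function.Injective (P.corner x) := fun k k' h => by
  rw [← sharpFun_vertex, ← sharpFun_vertex] at h
  exact CubeWord.vertex_injective (hx.sharpFun_injective h)

theorem exists_eq_sharpFun_line
    (hx : P.IsRegularCube x) (hstar : P.star (P.corner x k) 1 ⊆ Set.range ((P.sharp x).app 1))
    {e : P.cube 1} {b : Bool} (he : P.face b 0 e = P.corner x k) :
    ∃ j, k j = b ∧ e = sharpFun P x (CubeWord.line k j) := by
  obtain ⟨w, rfl⟩ := exists_sharpFun_eq hstar (mem_star_edge.2 ⟨b, he⟩)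
  obtain ⟨k', j, rfl⟩ := w.exists_eq_line
  rw [face_sharpFun_line] at he
  have hk := hx.corner_injective he
  refine ⟨j, by rw [← hk, Function.update_self], ?_⟩
  congr 1
  refine CubeWord.letter_injective ?_
  rw [CubeWord.letter_line, CubeWord.letter_line, ← hk]
  funext i
  by_cases hi : i = j
  · subst hi
    simp
  · simp [Function.update_of_ne hi]

/-- An edge lies in the star of a vertex only if that vertex is one of its endpoints. -/
theorem step_starCompl {v : P.cube 0} {a b : (P.starCompl v).toPrecubicalSet.cube 0}
    (h : P.Step a.1 b.1) : (P.starCompl v).toPrecubicalSet.Step a b := by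
  obtain ⟨e, h0, h1⟩ := h
  refine ⟨⟨e, fun hmem => ?_⟩, Subtype.ext h0, Subtype.ext h1⟩
  obtain ⟨c, hc⟩ := mem_star_edge.1 hmem
  cases c
  · exact a.2 (mem_star_vertex.2 (hc.symm.trans h0))
  · exact b.2 (mem_star_vertex.2 (hc.symm.trans h1))

theorem step_corner (x : P.cube n) (k : Fin n → Bool) {j : Fin n} (hj : k j = false) :
    P.Step (P.corner x k) (P.corner x (Function.update k j true)) :=
  ⟨sharpFun P x (CubeWord.line k j), by
    rw [face_sharpFun_line, ← hj, Function.update_eq_self], face_sharpFun_line x k j true⟩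

/-- Induction from the head of the path. The second clause is needed when the remaining path starts
at v: it then records the predecessor `u`, from which the detour departs. -/
theorem reroute (hx : P.IsRegularCube x)
    (hstar : P.star (P.corner x k) 1 ⊆ Set.range ((P.sharp x).app 1))
    {a b : P.cube 0} (hab : Relation.ReflTransGen P.Step a b)
    (hb : b ∈ (P.starCompl (P.corner x k)).carrier 0) :
    (∀ ha : a ∈ (P.starCompl (P.corner x k)).carrier 0,
      Relation.ReflTransGen (P.starCompl (P.corner x k)).toPrecubicalSet.Step ⟨a, ha⟩ ⟨b, hb⟩) ∧
    (P.corner x k = a → ∀ u (hu : u ∈ (P.starCompl (P.corner x k)).carrier 0), P.Step u a →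
      Relation.ReflTransGen (P.starCompl (P.corner x k)).toPrecubicalSet.Step ⟨u, hu⟩ ⟨b, hb⟩) := by
  induction hab using Relation.ReflTransGen.head_induction_on with
  | refl => exact ⟨fun _ => .refl, fun h => absurd (mem_star_vertex.2 h) hb⟩
  | @head a c hac _ ih =>
    constructor
    · intro ha
      by_cases hc : P.corner x k = c
      · exact ih.2 hc a ha hac
      · have hc' : c ∈ (P.starCompl (P.corner x k)).carrier 0 :=
          fun h => hc (mem_star_vertex.1 h)
        exact (ih.1 hc').head (step_starCompl hac)
    · rintro rfl u hu ⟨e, rfl, he⟩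
      obtain ⟨f, hf, rfl⟩ := hac
      obtain ⟨j, hj, rfl⟩ := exists_eq_sharpFun_line hx hstar he
      obtain ⟨i, hi, rfl⟩ := exists_eq_sharpFun_line hx hstar hf
      have hij : i ≠ j := by
        rintro rfl
        simp [hi] at hj
      have hmem : ∀ k', k ≠ k' → P.corner x k' ∈ (P.starCompl (P.corner x k)).carrier 0 :=
        fun k' hk h => hk (hx.corner_injective (mem_star_vertex.1 h))
      have hc : P.face true 0 (sharpFun P x (CubeWord.line k i)) ∈
          (P.starCompl (P.corner x k)).carrier 0 := by
        rw [face_sharpFun_line]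
        refine hmem _ fun h => ?_
        have := congrFun h i
        simp [hi] at this
      -- The fourth vertex of the square spanned by the incoming direction `j` (where `k` is 1) and
      -- the outgoing direction `i` (where `k` is 0): the detour flips `i` first and `j` second.
      have hm : P.corner x (Function.update (Function.update k j false) i true) ∈
          (P.starCompl (P.corner x k)).carrier 0 := by
        refine hmem _ fun h => ?_
        have := congrFun h i
        simp [hi] at this
      refine .head (b := ⟨_, hm⟩) (step_starCompl ?_)
        (.head (step_starCompl ?_) (ih.1 hc))
      · change P.Step (P.face false 0 (sharpFun P x (CubeWord.line k j))) (P.corner x _)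
        rw [face_sharpFun_line]
        exact step_corner x _ (by rw [Function.update_of_ne hij, hi])
      · change P.Step (P.corner x _) (P.face true 0 (sharpFun P x (CubeWord.line k i)))
        rw [face_sharpFun_line, Function.update_comm hij.symm]
        have h := step_corner x (Function.update (Function.update k i true) j false)
          (Function.update_self j _ _)
        rw [Function.update_idem] at h
        have h' : Function.update (Function.update k i true) j true =
            Function.update k i true := by
          rw [Function.update_eq_self_iff, Function.update_of_ne hij.symm, hj]
        rwa [h'] at h

theorem accessible_starCompl (hx : P.IsRegularCube x)
    (hstar : P.star (P.corner x k) 1 ⊆ Set.range ((P.sharp x).app 1))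
    {a b : (P.starCompl (P.corner x k)).toPrecubicalSet.cube 0} (h : P.Accessible a.1 b.1) :
    (P.starCompl (P.corner x k)).toPrecubicalSet.Accessible a b :=
  accessible_iff.2 ((reroute hx hstar (accessible_iff.1 h) b.2).1 a.2)

end reroute

/-! ### Sweeping a precubical subset along an edge -/

section sweep

variable {P : PrecubicalSet.{u}} {n : ℕ} (x : P.cube n)

/-- The face of `x` that has the letters `l` belongs to `X`. -/
def LettersMem (X : P.Subset) (l : Fin n → Option Bool) : Prop :=
  ∃ (m : ℕ) (w : CubeWord n m), w.letter = l ∧ sharpFun P x w ∈ X.carrier m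

variable {x}

theorem LettersMem.sharpFun_mem {X : P.Subset} {m : ℕ} {w : CubeWord n m}
    (h : LettersMem x X w.letter) : sharpFun P x w ∈ X.carrier m := by
  obtain ⟨m', w', hl, hw⟩ := h
  cases w'.sigma_eq_of_letter_eq w hl
  exact hw

theorem LettersMem.update {X : P.Subset} {l : Fin n → Option Bool} (h : LettersMem x X l)
    {i : Fin n} (hi : l i = none) (b : Bool) :
    LettersMem x X (Function.update l i (some b)) := by
  obtain ⟨m, w, rfl, hw⟩ := h
  cases m with
  | zero => exact absurd hi (w.letter_ne_none i)
  | succ m =>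
    obtain ⟨i', h'⟩ := w.exists_face_of_letter_eq_none hi
    refine ⟨m, w.face b i', h' b, ?_⟩
    have hf : sharpFun P x (w.face b i') = P.face b i' (sharpFun P x w) :=
      (P.sharp x).app_face b i' w
    exact hf ▸ X.face_mem b i' hw

variable (x)

/-- The union of `X` and the faces of `x` that are swept out by moving the cubes of `X` with the
`j`-th letter `b` in the direction `j`. -/
def sweep (X : P.Subset) (j : Fin n) (b : Bool) : P.Subset where
  carrier m := X.carrier m ∪ {y | ∃ w : CubeWord n m, sharpFun P x w = y ∧
    LettersMem x X (Function.update w.letter j (some b))}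
  face_mem := by
    rintro m c i y (hy | ⟨w, rfl, hw⟩)
    · exact .inl (X.face_mem c i hy)
    · refine .inr ⟨w.face c i, (P.sharp x).app_face c i w, ?_⟩
      obtain ⟨j', hj', h⟩ := w.exists_letter_face i
      rw [h]
      -- A letter put in the place `j` is overwritten by `b`; one put in another place commutes with
      -- this replacement.
      by_cases hjj : j' = j
      · subst hjj
        rwa [Function.update_idem]
      · rw [Function.update_comm hjj]
        exact hw.update (by rw [Function.update_of_ne hjj, hj']) c

variable {x} {k : Fin n → Bool}

theorem exists_homotopyEquiv_sweep (j : Fin n) (hx : P.IsRegularCube x)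
    (hstar : ∀ m : ℕ, P.star (P.corner x k) m ⊆ Set.range ((P.sharp x).app m)) (X : P.Subset) :
    ∃ e : ContinuousMap.HomotopyEquiv
        ((sweep x X j (k j)).inter (P.starCompl (P.corner x k))).toPrecubicalSet.Realization
        (sweep x X j (k j)).toPrecubicalSet.Realization,
      e.toFun = (Subset.inclusion
        (X := (sweep x X j (k j)).inter (P.starCompl (P.corner x k))) (Y := sweep x X j (k j))
        fun _ _ h => h.1).realization := by
  refine exists_homotopyEquiv_inter_starCompl k j hx hstar _ fun m w hw hws => ?_
  -- In the star the `j`-th letter is free or equal to `k j`, so in either case fixing it to `k j`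
  -- gives a face in X.
  have key : LettersMem x X (Function.update w.letter j (some (k j))) := by
    rcases hw with hw | ⟨w', hw', h⟩
    · have h0 : LettersMem x X w.letter := ⟨m, w, rfl, hw⟩
      rcases hj : w.letter j with _ | b
      · exact h0.update hj _
      · obtain rfl : b = k j := by
          have := hx.letter_ne_of_mem_star hws j
          rw [hj] at this
          revert this
          cases b <;> cases k j <;> simp
        rwa [← hj, Function.update_eq_self]
    · rwa [← hx.sharpFun_injective hw']
  obtain ⟨m', w', hw'⟩ := CubeWord.exists_letter_eq (Function.update w.letter j none)
  refine ⟨m', w', hw', .inr ⟨w', rfl, ?_⟩⟩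
  rwa [hw', Function.update_idem]

theorem exists_corner_of_mem_sweep {X : P.Subset} {j : Fin n} {b : Bool} {y : P.cube 0}
    (hy : y ∈ (sweep x X j b).carrier 0) :
    y ∈ X.carrier 0 ∨ ∃ k : Fin n → Bool, P.corner x (Function.update k j b) ∈ X.carrier 0 ∧
      y = P.corner x (Function.update k j (!b)) := by
  rcases hy with hy | ⟨w, rfl, hw⟩
  · exact .inl hy
  · obtain ⟨k, rfl⟩ := w.exists_eq_vertex
    have h1 : Function.update (CubeWord.vertex k).letter j (some b) =
        (CubeWord.vertex (Function.update k j b)).letter := by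
      rw [CubeWord.letter_vertex, CubeWord.letter_vertex]
      funext i
      by_cases hi : i = j
      · subst hi
        simp
      · simp [Function.update_of_ne hi]
    rw [h1] at hw
    have hmem := hw.sharpFun_mem
    rw [sharpFun_vertex] at hmem ⊢
    by_cases hb : k j = b
    · left
      rwa [← hb, Function.update_eq_self] at hmem
    · right
      refine ⟨k, hmem, ?_⟩
      have : k j = !b := by
        revert hb
        cases k j <;> cases b <;> simp
      rw [← this, Function.update_eq_self]

theorem step_update (x : P.cube n) (k : Fin n → Bool) (j : Fin n) :
    P.Step (P.corner x (Function.update k j false)) (P.corner x (Function.update k j true)) :=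
  ⟨sharpFun P x (CubeWord.line k j), face_sharpFun_line x k j false, face_sharpFun_line x k j true⟩

/-- A new vertex has 0 in the place `j` where its partner in X has 1, so the edge between them
points into X; for the letter 0 it points out of X. -/
theorem exists_accessible_of_mem_sweep_true {X : P.Subset} {j : Fin n} {y : P.cube 0}
    (hy : y ∈ (sweep x X j true).carrier 0) : ∃ z ∈ X.carrier 0, P.Accessible y z := by
  rcases exists_corner_of_mem_sweep hy with hy | ⟨k, hk, rfl⟩
  · exact ⟨y, hy, accessible_iff.2 .refl⟩
  · exact ⟨_, hk, accessible_iff.2 (.single (step_update x k j))⟩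

theorem exists_accessible_of_mem_sweep_false {X : P.Subset} {j : Fin n} {y : P.cube 0}
    (hy : y ∈ (sweep x X j false).carrier 0) : ∃ z ∈ X.carrier 0, P.Accessible z y := by
  rcases exists_corner_of_mem_sweep hy with hy | ⟨k, hk, rfl⟩
  · exact ⟨y, hy, accessible_iff.2 .refl⟩
  · exact ⟨_, hk, accessible_iff.2 (.single (step_update x k j))⟩

end sweep

/-! ### Functoriality of the homology -/

/-- The composition of morphisms. -/
def Hom.comp {P Q S : PrecubicalSet.{u}} (g : Hom Q S) (f : Hom P Q) : Hom P S where
  app n x := g.app n (f.app n x)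
  app_face k i x := by rw [f.app_face, g.app_face]

section homology

variable (R : Type v) [CommRing R] {P Q S : PrecubicalSet.{u}}

/-- The map in degree `n` induced by a continuous map. -/
noncomputable def homologyMapOf (f : C(P.Realization, Q.Realization)) (n : ℕ) :
    P.homology R n →ₗ[R] Q.homology R n :=
  (((AlgebraicTopology.singularHomologyFunctor.{u} (ModuleCat.{max u v} R) n).obj
      (ModuleCat.of R (ULift.{u} R))).map (TopCat.ofHom f)).hom

theorem homologyMapOf_id (n : ℕ) :
    homologyMapOf R (ContinuousMap.id P.Realization) n = LinearMap.id := by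
  unfold homologyMapOf
  rw [TopCat.ofHom_id, CategoryTheory.Functor.map_id]
  rfl

theorem homologyMapOf_comp (g : C(Q.Realization, S.Realization))
    (f : C(P.Realization, Q.Realization)) (n : ℕ) :
    homologyMapOf R (g.comp f) n = homologyMapOf R g n ∘ₗ homologyMapOf R f n := by
  unfold homologyMapOf
  rw [TopCat.ofHom_comp, CategoryTheory.Functor.map_comp]
  rfl

theorem homologyMapOf_eq_of_homotopic {f g : C(P.Realization, Q.Realization)}
    (h : f.Homotopic g) (n : ℕ) : homologyMapOf R f n = homologyMapOf R g n := by
  obtain ⟨H⟩ := h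
  have H' : TopCat.Homotopy (TopCat.ofHom f) (TopCat.ofHom g) := H
  exact congrArg ModuleCat.Hom.hom
    (H'.congr_homologyMap_singularChainComplexFunctor
      (ModuleCat.of R (ULift.{u} R) : ModuleCat.{max u v} R) n)

theorem Hom.homologyMap_eq (f : Hom P Q) :
    f.homologyMap R = DirectSum.lmap fun n => homologyMapOf R f.realization n := rfl

theorem Hom.homologyMap_comp (g : Hom Q S) (f : Hom P Q) :
    (g.comp f).homologyMap R = g.homologyMap R ∘ₗ f.homologyMap R := by
  have h : (g.comp f).realization = g.realization.comp f.realization := by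
    refine ContinuousMap.ext fun a => ?_
    obtain ⟨p, rfl⟩ := Quot.exists_rep a
    rfl
  simp only [Hom.homologyMap_eq, h, homologyMapOf_comp]
  exact DirectSum.lmap_comp _ _

theorem Hom.bijective_homologyMap (f : Hom P Q)
    (h : ∃ e : ContinuousMap.HomotopyEquiv P.Realization Q.Realization,
      e.toFun = f.realization) : Function.Bijective (f.homologyMap R) := by
  obtain ⟨e, he⟩ := h
  have h1 : (DirectSum.lmap fun n => homologyMapOf R e.invFun n) ∘ₗ f.homologyMap R =
      LinearMap.id := by
    rw [Hom.homologyMap_eq, ← he, ← DirectSum.lmap_comp]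
    simp only [← homologyMapOf_comp, homologyMapOf_eq_of_homotopic R e.left_inv,
      homologyMapOf_id]
    exact DirectSum.lmap_id
  have h2 : f.homologyMap R ∘ₗ (DirectSum.lmap fun n => homologyMapOf R e.invFun n) =
      LinearMap.id := by
    rw [Hom.homologyMap_eq, ← he, ← DirectSum.lmap_comp]
    simp only [← homologyMapOf_comp, homologyMapOf_eq_of_homotopic R e.right_inv,
      homologyMapOf_id]
    exact DirectSum.lmap_id
  exact Function.bijective_iff_has_inverse.2
    ⟨_, fun a => LinearMap.congr_fun h1 a, fun a => LinearMap.congr_fun h2 a⟩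

/-! ### The homology graph -/

theorem PointsTo.map (f : Hom P Q) {α β : P.TotalHomology R} (h : P.PointsTo R α β) :
    Q.PointsTo R (f.homologyMap R α) (f.homologyMap R β) := by
  obtain ⟨X, Y, ⟨a, rfl⟩, ⟨b, rfl⟩, hXY⟩ := h
  have key : ∀ (Z : P.Subset) (c : Z.toPrecubicalSet.TotalHomology R),
      f.homologyMap R (Z.incl.homologyMap R c) ∈
        LinearMap.range ((Z.map f).incl.homologyMap R) := by
    intro Z c
    let g : Hom Z.toPrecubicalSet (Z.map f).toPrecubicalSet :=
      ⟨fun n z => ⟨f.app n z.1, z.1, z.2, rfl⟩, fun k i z => Subtype.ext (f.app_face k i z.1)⟩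
    refine ⟨g.homologyMap R c, ?_⟩
    have h1 : (Z.map f).incl.comp g = f.comp Z.incl := rfl
    have h2 := congrArg (Hom.homologyMap R) h1
    rw [Hom.homologyMap_comp, Hom.homologyMap_comp] at h2
    exact LinearMap.congr_fun h2 c
  refine ⟨X.map f, Y.map f, key X a, key Y b, ?_⟩
  rintro _ ⟨x, hx, rfl⟩ _ ⟨y, hy, rfl⟩
  exact (hXY x hx y hy).map f

variable {R} {n : ℕ} {x : P.cube n} {k : Fin n → Bool}

/-- The class is pushed from X to the sweep and pulled back along the homotopy equivalence to the
part of the sweep inside Q. The result agrees with α because both have the same image in the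
homology of |P|, where ι_* is injective. -/
theorem mem_range_homologyMap_comap_sweep (j : Fin n) (hx : P.IsRegularCube x)
    (hstar : ∀ m : ℕ, P.star (P.corner x k) m ⊆ Set.range ((P.sharp x).app m)) (X : P.Subset)
    {α : (P.starCompl (P.corner x k)).toPrecubicalSet.TotalHomology R}
    (hα : (P.starCompl (P.corner x k)).incl.homologyMap R α ∈
      LinearMap.range (X.incl.homologyMap R)) :
    α ∈ LinearMap.range (((sweep x X j (k j)).comap
      (P.starCompl (P.corner x k)).incl).incl.homologyMap R) := by
  obtain ⟨a, ha⟩ := hα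
  let Q := P.starCompl (P.corner x k)
  let Z := sweep x X j (k j)
  let f : Hom X.toPrecubicalSet Z.toPrecubicalSet := Subset.inclusion fun _ _ h => .inl h
  let g : Hom (Z.inter Q).toPrecubicalSet Z.toPrecubicalSet := Subset.inclusion fun _ _ h => h.1
  let i : Hom (Z.inter Q).toPrecubicalSet (Z.comap Q.incl).toPrecubicalSet :=
    ⟨fun n z => ⟨⟨z.1, z.2.2⟩, z.2.1⟩, fun _ _ _ => rfl⟩
  obtain ⟨b, hb⟩ := (g.bijective_homologyMap R (exists_homotopyEquiv_sweep j hx hstar X)).2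
    (f.homologyMap R a)
  refine ⟨i.homologyMap R b, (Q.incl.bijective_homologyMap R
    (exists_homotopyEquiv_starCompl k j hx hstar)).1 ?_⟩
  have h1 : X.incl = Z.incl.comp f := rfl
  have h2 : Q.incl.comp ((Z.comap Q.incl).incl.comp i) = Z.incl.comp g := rfl
  have h2 := LinearMap.congr_fun (congrArg (Hom.homologyMap R) h2) b
  simp only [Hom.homologyMap_comp, LinearMap.comp_apply] at h2
  rw [h1, Hom.homologyMap_comp, LinearMap.comp_apply, ← hb] at ha
  exact h2.trans ha

theorem PointsTo.of_map_incl_starCompl (h0 : ∃ i, k i = false) (h1 : ∃ i, k i = true)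
    (hx : P.IsRegularCube x)
    (hstar : ∀ m : ℕ, P.star (P.corner x k) m ⊆ Set.range ((P.sharp x).app m))
    {α β : (P.starCompl (P.corner x k)).toPrecubicalSet.TotalHomology R}
    (h : P.PointsTo R ((P.starCompl (P.corner x k)).incl.homologyMap R α)
      ((P.starCompl (P.corner x k)).incl.homologyMap R β)) :
    (P.starCompl (P.corner x k)).toPrecubicalSet.PointsTo R α β := by
  obtain ⟨X, Y, hα, hβ, hXY⟩ := h
  obtain ⟨i, hi⟩ := h0
  obtain ⟨j, hj⟩ := h1
  -- The directions are chosen crosswise: X grows only backwards along edges (`k j` is 1), Y only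
  -- forwards (`k i` is 0).
  refine ⟨_, _, mem_range_homologyMap_comap_sweep j hx hstar X hα,
    mem_range_homologyMap_comap_sweep i hx hstar Y hβ, fun a ha b hb => ?_⟩
  have ha : a.1 ∈ (sweep x X j (k j)).carrier 0 := ha
  have hb : b.1 ∈ (sweep x Y i (k i)).carrier 0 := hb
  rw [hj] at ha
  rw [hi] at hb
  obtain ⟨a', ha', haa⟩ := exists_accessible_of_mem_sweep_true ha
  obtain ⟨b', hb', hbb⟩ := exists_accessible_of_mem_sweep_false hb
  exact accessible_starCompl hx (hstar 1) ((haa.trans (hXY a' ha' b' hb')).trans hbb)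

end homology

end PrecubicalSet

theorem theorem4 (R : Type v) [CommRing R] (P : PrecubicalSet.{u}) (n : ℕ) (hn : 2 ≤ n)
    (x : P.cube n) (hx : P.IsRegularCube x) (k : Fin n → Bool)
    (h0 : ∃ i, k i = false) (h1 : ∃ i, k i = true)
    (hstar : ∀ m : ℕ, P.star (P.corner x k) m ⊆ Set.range ((P.sharp x).app m)) :
    (∃ e : ContinuousMap.HomotopyEquiv
        (P.starCompl (P.corner x k)).toPrecubicalSet.Realization P.Realization,
      e.toFun = (P.starCompl (P.corner x k)).incl.realization) ∧
    (∃ e : ((P.starCompl (P.corner x k)).toPrecubicalSet.homologyGraph R).Adj ≃r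
        (P.homologyGraph R).Adj,
      ⇑e = (P.starCompl (P.corner x k)).incl.homologyMap R) := by
  -- Any direction is good enough for the deformation of |P|; `h0` merely supplies one.
  have he := PrecubicalSet.exists_homotopyEquiv_starCompl k h0.choose hx hstar
  refine ⟨he, ⟨⟨Equiv.ofBijective _ ((P.starCompl (P.corner x k)).incl.bijective_homologyMap R he),
    fun {α β} => ?_⟩, rfl⟩⟩
  exact ⟨fun h => .of_map_incl_starCompl h0 h1 hx hstar h, fun h => h.map R _⟩
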